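/- **Definitions.** An *abstract arrangement* $A$ consists of a finite set of "points", a finite set of "lines" and an incidence relation $\iota(v,l)$ between points and lines; it is *admissible* if every point is incident to at least two distinct lines and every line to at least two distinct points. A *monomorphism* of arrangements is an injective map that sends points to points, lines to lines and incident pairs to incident pairs. The *standard triangle* $T$ has points $v_{00},v_x,v_y,v_{11},v_{10},v_{01}$ and lines $l_x,l_y,l_\infty,l_d,l_{y1},l_{x1}$, where $l_x$ contains $v_{00},v_x,v_{10}$; $l_y$ contains $v_{00},v_y,v_{01}$; $l_\infty$ contains $v_x,v_y$; $l_d$ contains $v_{00},v_{11}$; $l_{y1}$ contains $v_{10},v_y,v_{11}$; $l_{x1}$ contains $v_{01},v_x,v_{11}$. A *marked based arrangement* is an arrangement $A$ with a monomorphism $T\hookrightarrow A$ and a set $\nu$ of points of $A$ (the marking), all incident to $l_x$. For a commutative ring $R$ let $\mathbb P^2(R)$ be the set of projective rank one submodules $V\subset R^3$ with $R^3/V$ projective, and $\mathbb P^2(R)^\vee$ the same for the dual module of $R^3$; $[x:y:z]$ denotes the element generated by $(x,y,z)$ (in the dual module: in the dual basis), and $V$ lies on $L\in\mathbb P^2(R)^\vee$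 if $L(V)=0$. A *finite based realization* of $A$ over $R$ assigns to every point of $A$ an element of $\mathbb P^2(R)$ and to every line of $A$ an element of $\mathbb P^2(R)^\vee$ such that incident elements are sent to incident elements; the elements of $T$ have their standard positions $v_{00}\mapsto[0:0:1]$, $v_x\mapsto[1:0:0]$, $v_y\mapsto[0:1:0]$, $v_{11}\mapsto[1:1:1]$, $v_{10}\mapsto[1:0:1]$, $v_{01}\mapsto[0:1:1]$, $l_x\mapsto L_x=[0:1:0]$, $l_y\mapsto L_y=[1:0:0]$, $l_\infty\mapsto L_\infty=[0:0:1]$, $l_d\mapsto L_d=[1:-1:0]$, $l_{y1}\mapsto[1:0:-1]$, $l_{x1}\mapsto[0:1:-1]$; and every marked point is sent to a complement of $Re_1+Re_2$ in $R^3$ (a point of $\mathbb P^2-L_\infty$). $BR_0(A)$ is the scheme over $\mathbb Q$ whose set of $R$-points, functorially in the commutative $\mathbb Q$-algebra $R$, is the set of finite based realizations of $A$ over $R$. An *affine variety over* $\mathbb Q$ is an affine scheme of finite type over $\mathbb Q$ (not necessarily reduced or irreducible). **Theorem.** 1. For every affine variety $S$ over $\mathbb Q$ there is a marked based arrangement $A$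 such that $BR_0(A)\cong S$ as schemes over $\mathbb Q$. 2. For all $n,m\ge 0$ and $f_1,\dots,f_m\in\mathbb Z[x_1,\dots,x_n]$ there is an admissible marked based arrangement $A$ with marking $\nu=\{v_1,\dots,v_n\}$ ($v_j$ distinct) such that the map $\tau$ that sends a realization $\psi$ to $(x_1,\dots,x_n)$, where $\psi(v_j)=[x_j:0:1]$, is an isomorphism of schemes over $\mathbb Q$ from $BR_0(A)$ onto the subscheme $\operatorname{Spec}\mathbb Q[x_1,\dots,x_n]/(f_1,\dots,f_m)$ of $\mathbb A^n_{\mathbb Q}$. 3. For every affine variety $S$ over $\mathbb Q$ and every rational point $q\in S(\mathbb Q)$ there are an admissible marked based arrangement $A$ and an isomorphism $geo:S\to BR_0(A)$ of schemes over $\mathbb Q$ such that the realization $\psi=geo(q)$ over $\mathbb Q$ satisfies $\psi(l)\in\{L_x,L_y,L_d\}$ for every line $l$ of $A$ outside of $T$, and $\psi(v)\in\{[0:0:1],[0:1:0],[1:0:0],[1:1:0]\}$ for every point $v$ of $A$ outside of $T$. -/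

import Mathlib

open CategoryTheory AlgebraicGeometry

/-! ### Abstract arrangements -/

/-- An abstract arrangement: a finite set of points, a finite set of lines, and an incidence
relation (`Inc v l` reads "the point `v` lies on the line `l`"). -/
structure Arrangement where
  Pt : Type
  Ln : Type
  finite_pt : Finite Pt
  finite_ln : Finite Ln
  Inc : Pt → Ln → Prop

namespace Arrangement

/-- A morphism of arrangements: points go to points, lines to lines, incidences to incidences. -/
structure Hom (A B : Arrangement) where
  pt : A.Pt → B.Pt
  ln : A.Ln → B.Ln
  inc : ∀ v l, A.Inc v l → B.Inc (pt v) (ln l)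

/-- A monomorphism of arrangements is an injective morphism. -/
def Hom.IsMono {A B : Arrangement} (φ : Hom A B) : Prop :=
  Function.Injective φ.pt ∧ Function.Injective φ.ln

/-- Every element is incident to at least two distinct elements. -/
def IsAdmissible (A : Arrangement) : Prop :=
  (∀ v : A.Pt, ∃ l l' : A.Ln, l ≠ l' ∧ A.Inc v l ∧ A.Inc v l') ∧
  (∀ l : A.Ln, ∃ v v' : A.Pt, v ≠ v' ∧ A.Inc v l ∧ A.Inc v' l)

end Arrangement

/-- The points of the standard triangle. -/
inductive TrianglePt
  | v00 | vx | vy | v11 | v10 | v01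

/-- The lines of the standard triangle. -/
inductive TriangleLn
  | lx | ly | linf | ld | ly1 | lx1

/-- The incidences of the standard triangle. -/
inductive TriangleInc : TrianglePt → TriangleLn → Prop
  | v00_lx : TriangleInc .v00 .lx
  | v00_ly : TriangleInc .v00 .ly
  | v00_ld : TriangleInc .v00 .ld
  | vx_lx : TriangleInc .vx .lx
  | vx_linf : TriangleInc .vx .linf
  | vx_lx1 : TriangleInc .vx .lx1
  | vy_ly : TriangleInc .vy .ly
  | vy_linf : TriangleInc .vy .linf
  | vy_ly1 : TriangleInc .vy .ly1
  | v11_ld : TriangleInc .v11 .ld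
  | v11_ly1 : TriangleInc .v11 .ly1
  | v11_lx1 : TriangleInc .v11 .lx1
  | v10_lx : TriangleInc .v10 .lx
  | v10_ly1 : TriangleInc .v10 .ly1
  | v01_ly : TriangleInc .v01 .ly
  | v01_lx1 : TriangleInc .v01 .lx1

instance : Finite TrianglePt :=
  Finite.of_surjective
    (![.v00, .vx, .vy, .v11, .v10, .v01] : Fin 6 → TrianglePt) (by
      rintro (_ | _)
      exacts [⟨0, rfl⟩, ⟨1, rfl⟩, ⟨2, rfl⟩, ⟨3, rfl⟩, ⟨4, rfl⟩, ⟨5, rfl⟩])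

instance : Finite TriangleLn :=
  Finite.of_surjective
    (![.lx, .ly, .linf, .ld, .ly1, .lx1] : Fin 6 → TriangleLn) (by
      rintro (_ | _)
      exacts [⟨0, rfl⟩, ⟨1, rfl⟩, ⟨2, rfl⟩, ⟨3, rfl⟩, ⟨4, rfl⟩, ⟨5, rfl⟩])

/-- The standard triangle `T` (a triangle with the complete set of bisectors). -/
def standardTriangle : Arrangement where
  Pt := TrianglePt
  Ln := TriangleLn
  finite_pt := inferInstance
  finite_ln := inferInstance
  Inc := TriangleInc

/-- A based arrangement: an arrangement with a monomorphism from the standard triangle. -/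
structure BasedArrangement extends Arrangement where
  base : Arrangement.Hom standardTriangle toArrangement
  base_isMono : base.IsMono

/-- A marked based arrangement: a based arrangement with a distinguished (finite) set of points,
all of them on the line `l_x` of the canonically embedded standard triangle. -/
structure MarkedArrangement extends BasedArrangement where
  mark : Set Pt
  mark_inc : ∀ v ∈ mark, Inc v (base.ln TriangleLn.lx)

/-! ### The projective plane over a commutative ring -/

/-- `ℙ²(R)`: the projective submodules of rank one of `R³` with projective quotient. -/
@[ext]
structure ProjPlane (R : Type*) [CommRing R] where
  carrier : Submodule R (Fin 3 → R)
  projective : Module.Projective R carrier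
  projective_quotient : Module.Projective R ((Fin 3 → R) ⧸ carrier)
  rank_eq_one : ∀ p : PrimeSpectrum R, Module.rankAtStalk (R := R) carrier p = 1

/-- Lines in the projective plane, i.e. points of the dual plane `ℙ((R³)ᵛ)`. Linear forms on `R³`
are written in coordinates with respect to the basis dual to the standard one, so that the form
with coordinates `a` takes the value `a ⬝ᵥ u` at `u`. -/
abbrev DualProjPlane (R : Type*) [CommRing R] := ProjPlane R

section BaseChange

variable {R S T : Type*} [CommRing R] [CommRing S] [CommRing T]

/-- The `S`-submodule of `S³` generated by the image of a submodule of `R³` under `f : R → S`. -/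
def Submodule.extendScalars (f : R →+* S) (V : Submodule R (Fin 3 → R)) :
    Submodule S (Fin 3 → S) :=
  Submodule.span S ((fun u : Fin 3 → R => f ∘ u) '' (V : Set (Fin 3 → R)))

theorem Submodule.mem_extendScalars (f : R →+* S) {V : Submodule R (Fin 3 → R)} {u : Fin 3 → R}
    (hu : u ∈ V) : f ∘ u ∈ V.extendScalars f :=
  Submodule.subset_span ⟨u, hu, rfl⟩

theorem Submodule.extendScalars_span (f : R →+* S) (s : Set (Fin 3 → R)) :
    (Submodule.span R s).extendScalars f =
      Submodule.span S ((fun u : Fin 3 → R => f ∘ u) '' s) := by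
  apply le_antisymm
  · refine Submodule.span_le.2 ?_
    rintro _ ⟨u, hu, rfl⟩
    refine Submodule.span_induction (p := fun u _ => f ∘ u ∈ _) ?_ ?_ ?_ ?_ hu
    · exact fun x hx => Submodule.subset_span ⟨x, hx, rfl⟩
    · have : f ∘ (0 : Fin 3 → R) = 0 := by ext i; simp
      rw [this]; exact zero_mem _
    · intro x y _ _ hx hy
      have : f ∘ (x + y) = f ∘ x + f ∘ y := by ext i; simp
      rw [this]; exact add_mem hx hy
    · intro a x _ hx
      have : f ∘ (a • x) = f a • (f ∘ x) := by ext i; simp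
      rw [this]; exact Submodule.smul_mem _ _ hx
  · exact Submodule.span_mono (Set.image_mono Submodule.subset_span)

theorem Submodule.extendScalars_id (V : Submodule R (Fin 3 → R)) :
    V.extendScalars (RingHom.id R) = V := by
  simp [Submodule.extendScalars]

theorem Submodule.extendScalars_comp (f : R →+* S) (g : S →+* T)
    (V : Submodule R (Fin 3 → R)) :
    V.extendScalars (g.comp f) = (V.extendScalars f).extendScalars g := by
  have h := Submodule.extendScalars_span g
    ((fun u : Fin 3 → R => f ∘ u) '' (V : Set (Fin 3 → R)))
  rw [Set.image_image] at h
  exact h.symm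

/-- A linear map on `R³` extends to `S³`. -/
theorem exists_extend_linearMap (f : R →+* S) {Q : Type*} [AddCommGroup Q] [Module S Q]
    (q : (Fin 3 → R) → Q) (hadd : ∀ x y, q (x + y) = q x + q y)
    (hsmul : ∀ (a : R) x, q (a • x) = f a • q x) :
    ∃ q' : (Fin 3 → S) →ₗ[S] Q, ∀ u : Fin 3 → R, q' (f ∘ u) = q u := by
  refine ⟨Fintype.linearCombination S (fun i => q (Pi.single i 1)), fun u => ?_⟩
  have h0 : q 0 = 0 := by simpa using hsmul 0 0
  let q₀ : (Fin 3 → R) →+ Q := { toFun := q, map_zero' := h0, map_add' := hadd }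
  have hu : u = ∑ i, u i • (Pi.single i 1 : Fin 3 → R) := by
    ext j; simp [Finset.sum_apply, Pi.single_apply]
  have h1 : q u = ∑ i, q (u i • (Pi.single i 1 : Fin 3 → R)) := by
    conv_lhs => rw [hu]
    exact map_sum q₀ _ _
  rw [h1, Fintype.linearCombination_apply]
  exact Finset.sum_congr rfl fun i _ => (hsmul _ _).symm

theorem Submodule.isCompl_extendScalars (f : R →+* S) {V W : Submodule R (Fin 3 → R)}
    (h : IsCompl V W) : IsCompl (V.extendScalars f) (W.extendScalars f) := by
  obtain ⟨q, hq⟩ := exists_extend_linearMap (Q := Fin 3 → S) f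
    (fun u => f ∘ (V.projection W h u))
    (fun x y => by ext i; simp) (fun a x => by ext i; simp)
  have hV : ∀ x ∈ V.extendScalars f, q x = x := by
    intro x hx
    refine Submodule.span_induction (p := fun x _ => q x = x) ?_ (map_zero q) ?_ ?_ hx
    · rintro _ ⟨u, hu, rfl⟩
      show q (f ∘ u) = f ∘ u
      rw [hq]
      congr 1
      exact Submodule.projection_apply_left h ⟨u, hu⟩
    · intro x y _ _ hx hy; rw [map_add, hx, hy]
    · intro a x _ hx; rw [map_smul, hx]
  have hW : ∀ x ∈ W.extendScalars f, q x = 0 := by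
    intro x hx
    refine Submodule.span_induction (p := fun x _ => q x = 0) ?_ (map_zero q) ?_ ?_ hx
    · rintro _ ⟨u, hu, rfl⟩
      show q (f ∘ u) = 0
      rw [hq]
      have : V.projection W h u = 0 := by simpa using hu
      rw [this]; ext i; simp
    · intro x y _ _ hx hy; rw [map_add, hx, hy, add_zero]
    · intro a x _ hx; rw [map_smul, hx, smul_zero]
  refine IsCompl.of_eq ?_ ?_
  · rw [eq_bot_iff]
    rintro x ⟨h1, h2⟩
    rw [Submodule.mem_bot, ← hV x h1, hW x h2]
  · rw [eq_top_iff]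
    intro x _
    have hx : x = ∑ i, x i • (f ∘ (Pi.single i 1 : Fin 3 → R)) := by
      ext j; simp [Finset.sum_apply, Pi.single_apply, apply_ite f]
    rw [hx]
    refine Submodule.sum_mem _ fun i _ => Submodule.smul_mem _ _ ?_
    have hi : (Pi.single i 1 : Fin 3 → R) ∈ V ⊔ W := by rw [h.sup_eq_top]; trivial
    obtain ⟨v, hv, w, hw, hvw⟩ := Submodule.mem_sup.1 hi
    have : f ∘ (Pi.single i 1 : Fin 3 → R) = f ∘ v + f ∘ w := by
      rw [← hvw]; ext i; simp
    rw [this]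
    exact Submodule.add_mem_sup (Submodule.mem_extendScalars f hv)
      (Submodule.mem_extendScalars f hw)

theorem Submodule.exists_isCompl_of_projective_quotient (V : Submodule R (Fin 3 → R))
    (h : Module.Projective R ((Fin 3 → R) ⧸ V)) : ∃ W, IsCompl V W := by
  obtain ⟨s, hs⟩ := Module.projective_lifting_property V.mkQ LinearMap.id V.mkQ_surjective
  have hs' : ∀ x, V.mkQ (s x) = x := fun x => LinearMap.congr_fun hs x
  have hm : ∀ x, ((LinearMap.id : (Fin 3 → R) →ₗ[R] _) - s ∘ₗ V.mkQ) x ∈ V := fun x => by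
    rw [← Submodule.Quotient.mk_eq_zero, ← Submodule.mkQ_apply]
    simp only [LinearMap.sub_apply, LinearMap.id_apply, LinearMap.comp_apply, map_sub, hs',
      sub_self]
  refine ⟨LinearMap.ker ((LinearMap.id - s ∘ₗ V.mkQ).codRestrict V hm),
    LinearMap.isCompl_of_proj fun x => Subtype.ext ?_⟩
  have : V.mkQ (x : Fin 3 → R) = 0 := by simp
  simp only [LinearMap.codRestrict_apply, LinearMap.sub_apply, LinearMap.id_apply,
    LinearMap.comp_apply, this, map_zero, sub_zero]

theorem Submodule.projective_of_isCompl {V W : Submodule R (Fin 3 → R)} (h : IsCompl V W) :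
    Module.Projective R V :=
  Module.Projective.of_split V.subtype (V.projectionOnto W h) (by ext x; simp)

theorem Submodule.rankAtStalk_extendScalars (f : R →+* S) {V W : Submodule R (Fin 3 → R)}
    (h : IsCompl V W) (p : PrimeSpectrum S) :
    Module.rankAtStalk (R := S) (V.extendScalars f) p =
      Module.rankAtStalk (R := R) V (p.comap f) := by
  have hproj := Submodule.projective_of_isCompl h
  have hfin : Module.Finite R V :=
    Module.Finite.of_surjective (V.projectionOnto W h)
      (fun x => ⟨x, Submodule.projectionOnto_apply_left h x⟩)
  let : Algebra R S := f.toAlgebra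
  let : Module R (V.extendScalars f) := Module.compHom _ f
  have : IsScalarTower R S (V.extendScalars f) :=
    ⟨fun a b x => by
      show (f a * b) • x = f a • (b • x)
      exact mul_smul _ _ _⟩
  let ι : V →ₗ[R] V.extendScalars f :=
    { toFun := fun u => ⟨f ∘ (u : Fin 3 → R), Submodule.mem_extendScalars f u.2⟩
      map_add' := fun x y => by ext i; simp
      map_smul' := fun a x => by
        ext i
        show f (a * (x : Fin 3 → R) i) = f a * f ((x : Fin 3 → R) i)
        exact map_mul f _ _ }
  have hb : IsBaseChange S ι := by
    refine IsBaseChange.of_lift_unique ι fun Q _ _ _ _ g => ?_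
    let : AddCommGroup Q := Module.addCommMonoidToAddCommGroup S
    obtain ⟨q, hq⟩ := exists_extend_linearMap (Q := Q) f
      (fun u => g (V.projectionOnto W h u))
      (fun x y => by simp) (fun a x => by
        rw [map_smul, map_smul]; exact (algebraMap_smul S a _).symm)
    refine ⟨q ∘ₗ (V.extendScalars f).subtype, ?_, ?_⟩
    · ext u
      show q (f ∘ (u : Fin 3 → R)) = g u
      rw [hq, Submodule.projectionOnto_apply_left]
    · intro q' hq'
      ext ⟨x, hx⟩
      show q' ⟨x, hx⟩ = q x
      refine Submodule.span_induction
        (p := fun x hx => q' ⟨x, hx⟩ = q x) ?_ ?_ ?_ ?_ hx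
      · rintro _ ⟨u, hu, rfl⟩
        show _ = q (f ∘ u)
        rw [hq]
        have := LinearMap.congr_fun hq' ⟨u, hu⟩
        have e : V.projectionOnto W h u = ⟨u, hu⟩ := Submodule.projectionOnto_apply_left h ⟨u, hu⟩
        rw [e]
        exact this
      · rw [map_zero]; exact map_zero q'
      · intro x y hx' hy' h1 h2
        rw [map_add, ← h1, ← h2, ← map_add]; rfl
      · intro a x hx' h1
        rw [map_smul, ← h1, ← map_smul]; rfl
  exact Module.rankAtStalk_isBaseChange hb p

/-- Extension of scalars of points of the projective plane along `f : R → S`. -/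
def ProjPlane.map (f : R →+* S) (V : ProjPlane R) : ProjPlane S where
  carrier := V.carrier.extendScalars f
  projective := by
    obtain ⟨W, hW⟩ := V.carrier.exists_isCompl_of_projective_quotient V.projective_quotient
    exact Submodule.projective_of_isCompl (Submodule.isCompl_extendScalars f hW)
  projective_quotient := by
    obtain ⟨W, hW⟩ := V.carrier.exists_isCompl_of_projective_quotient V.projective_quotient
    have h := Submodule.isCompl_extendScalars f hW
    have := Submodule.projective_of_isCompl h.symm
    exact Module.Projective.of_equiv (Submodule.quotientEquivOfIsCompl _ _ h).symm
  rank_eq_one := fun p => by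
    obtain ⟨W, hW⟩ := V.carrier.exists_isCompl_of_projective_quotient V.projective_quotient
    rw [Submodule.rankAtStalk_extendScalars f hW, V.rank_eq_one]

theorem ProjPlane.map_id (V : ProjPlane R) : V.map (RingHom.id R) = V :=
  ProjPlane.ext V.carrier.extendScalars_id

theorem ProjPlane.map_comp (f : R →+* S) (g : S →+* T) (V : ProjPlane R) :
    V.map (g.comp f) = (V.map f).map g :=
  ProjPlane.ext (V.carrier.extendScalars_comp f g)

/-- The point `V` lies on the line `L`: the linear forms in `L` vanish on `V`. -/
def ProjPlane.LiesOn (V : ProjPlane R) (L : DualProjPlane R) : Prop :=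
  ∀ a ∈ L.carrier, ∀ u ∈ V.carrier, a ⬝ᵥ u = 0

theorem ProjPlane.LiesOn.map (f : R →+* S) {V : ProjPlane R} {L : DualProjPlane R}
    (h : V.LiesOn L) : (V.map f).LiesOn (L.map f) := by
  intro a ha u hu
  refine Submodule.span_induction (p := fun a _ => a ⬝ᵥ u = 0) ?_ (zero_dotProduct u) ?_ ?_ ha
  · rintro _ ⟨a, ha, rfl⟩
    refine Submodule.span_induction (p := fun u _ => (f ∘ a) ⬝ᵥ u = 0) ?_
      (dotProduct_zero _) ?_ ?_ hu
    · rintro _ ⟨u, hu, rfl⟩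
      have := congrArg f (h a ha u hu)
      rw [map_zero, RingHom.map_dotProduct] at this
      exact this
    · intro x y _ _ hx hy; rw [dotProduct_add, hx, hy, add_zero]
    · intro c x _ hx; rw [dotProduct_smul, hx, smul_zero]
  · intro x y _ _ hx hy; rw [add_dotProduct, hx, hy, add_zero]
  · intro c x _ hx; rw [smul_dotProduct, hx, smul_zero]

/-- The point (or line) with homogeneous coordinates `u`: `V` is the submodule generated by `u`. -/
def ProjPlane.HasCoords (V : ProjPlane R) (u : Fin 3 → R) : Prop :=
  V.carrier = Submodule.span R {u}

theorem ProjPlane.HasCoords.map (f : R →+* S) {V : ProjPlane R} {u : Fin 3 → R}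
    (h : V.HasCoords u) : (V.map f).HasCoords (f ∘ u) := by
  show V.carrier.extendScalars f = _
  rw [show V.carrier = _ from h, Submodule.extendScalars_span, Set.image_singleton]

/-- The line at infinity `z = 0`, as the submodule of `R³` spanned by the first two standard
basis vectors. -/
def lineAtInfinity (R : Type*) [CommRing R] : Submodule R (Fin 3 → R) :=
  Submodule.span R {![1, 0, 0], ![0, 1, 0]}

/-- The points of `ℙ² - L_∞`. -/
def ProjPlane.IsFinite (V : ProjPlane R) : Prop :=
  IsCompl V.carrier (lineAtInfinity R)

theorem ProjPlane.IsFinite.map (f : R →+* S) {V : ProjPlane R} (h : V.IsFinite) :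
    (V.map f).IsFinite := by
  have e : (lineAtInfinity R).extendScalars f = lineAtInfinity S := by
    rw [lineAtInfinity, Submodule.extendScalars_span, Set.image_pair, lineAtInfinity]
    congr 2
    · ext i; fin_cases i <;> simp
    · congr 1; ext i; fin_cases i <;> simp
  have := Submodule.isCompl_extendScalars f h
  rw [e] at this
  exact this

/-! ### Realizations of arrangements -/

/-- Homogeneous coordinates of the points in the standard realization of the standard triangle. -/
def stdPt (R : Type*) [CommRing R] : TrianglePt → Fin 3 → R
  | .v00 => ![0, 0, 1]
  | .vx => ![1, 0, 0]
  | .vy => ![0, 1, 0]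
  | .v11 => ![1, 1, 1]
  | .v10 => ![1, 0, 1]
  | .v01 => ![0, 1, 1]

/-- Homogeneous coordinates of the lines in the standard realization of the standard triangle:
`y = 0`, `x = 0`, `z = 0`, `x = y`, `x = z`, `y = z`. -/
def stdLn (R : Type*) [CommRing R] : TriangleLn → Fin 3 → R
  | .lx => ![0, 1, 0]
  | .ly => ![1, 0, 0]
  | .linf => ![0, 0, 1]
  | .ld => ![1, -1, 0]
  | .ly1 => ![1, 0, -1]
  | .lx1 => ![0, 1, -1]

theorem map_stdPt (f : R →+* S) (t : TrianglePt) : f ∘ stdPt R t = stdPt S t := by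
  cases t <;> ext i <;> fin_cases i <;> simp [stdPt]

theorem map_stdLn (f : R →+* S) (t : TriangleLn) : f ∘ stdLn R t = stdLn S t := by
  cases t <;> ext i <;> fin_cases i <;> simp [stdLn]

/-- The standard realization respects the incidences of the standard triangle. -/
theorem std_inc (t : TrianglePt) (l : TriangleLn) (h : TriangleInc t l) :
    stdLn R l ⬝ᵥ stdPt R t = 0 := by
  cases h <;> simp [stdLn, stdPt, dotProduct, Fin.sum_univ_three]

/-- A projective realization of the arrangement `A` over `R`, i.e. an `R`-point of `R(A)`. -/
@[ext]
structure Realization (A : Arrangement) (R : Type*) [CommRing R] where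
  pt : A.Pt → ProjPlane R
  ln : A.Ln → DualProjPlane R
  inc : ∀ v l, A.Inc v l → (pt v).LiesOn (ln l)

/-- Extension of scalars of realizations. -/
def Realization.map {A : Arrangement} (f : R →+* S) (ψ : Realization A R) : Realization A S where
  pt v := (ψ.pt v).map f
  ln l := (ψ.ln l).map f
  inc v l h := (ψ.inc v l h).map f

theorem Realization.map_id {A : Arrangement} (ψ : Realization A R) :
    ψ.map (RingHom.id R) = ψ :=
  Realization.ext (funext fun v => (ψ.pt v).map_id) (funext fun l => (ψ.ln l).map_id)

theorem Realization.map_comp {A : Arrangement} (f : R →+* S) (g : S →+* T)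
    (ψ : Realization A R) : ψ.map (g.comp f) = (ψ.map f).map g :=
  Realization.ext (funext fun v => (ψ.pt v).map_comp f g) (funext fun l => (ψ.ln l).map_comp f g)

/-- The realization is based: its restriction to the canonically embedded standard triangle is
the standard realization. -/
def BasedArrangement.IsBased (A : BasedArrangement) (ψ : Realization A.toArrangement R) : Prop :=
  (∀ t : TrianglePt, (ψ.pt (A.base.pt t)).HasCoords (stdPt R t)) ∧
  (∀ t : TriangleLn, (ψ.ln (A.base.ln t)).HasCoords (stdLn R t))

/-- The realization is finite: no marked point is sent to the line at infinity. -/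
def MarkedArrangement.IsFinite (A : MarkedArrangement) (ψ : Realization A.toArrangement R) :
    Prop :=
  ∀ v ∈ A.mark, (ψ.pt v).IsFinite

/-- The set `BR₀(A)(R)` of finite based realizations of `A` over `R`. -/
def MarkedArrangement.FiniteBasedRealization (A : MarkedArrangement) (R : Type*) [CommRing R] :=
  {ψ : Realization A.toArrangement R // A.toBasedArrangement.IsBased ψ ∧ A.IsFinite ψ}

/-- Extension of scalars of finite based realizations. -/
def MarkedArrangement.FiniteBasedRealization.map {A : MarkedArrangement} (f : R →+* S)
    (ψ : A.FiniteBasedRealization R) : A.FiniteBasedRealization S :=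
  ⟨ψ.1.map f,
    ⟨fun t => map_stdPt f t ▸ (ψ.2.1.1 t).map f, fun t => map_stdLn f t ▸ (ψ.2.1.2 t).map f⟩,
    fun v hv => (ψ.2.2 v hv).map f⟩

end BaseChange

/-- The scheme `BR₀(A)` over `ℚ` of finite based realizations of `A`, given by its functor of
points on commutative `ℚ`-algebras. -/
def MarkedArrangement.BR₀ (A : MarkedArrangement) : CommAlgCat.{0} ℚ ⥤ Type where
  obj R := A.FiniteBasedRealization R
  map f := ↾(MarkedArrangement.FiniteBasedRealization.map f.hom.toRingHom)
  map_id _ := by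
    ext ψ
    exact Subtype.ext ψ.1.map_id
  map_comp f g := by
    ext ψ
    exact Subtype.ext (ψ.1.map_comp f.hom.toRingHom g.hom.toRingHom)

noncomputable section

/-- The base scheme `Spec ℚ`. -/
abbrev SpecQ : Scheme.{0} := Spec (CommRingCat.of ℚ)

/-- The functor of points `R ↦ S(R) = Hom_ℚ(Spec R, S)` of a `ℚ`-scheme `S`, on commutative
`ℚ`-algebras. A scheme over `ℚ` is determined by it, and morphisms of schemes over `ℚ` are the
same as natural transformations between these functors. -/
def pointsFunctor (S : Over SpecQ) : CommAlgCat.{0} ℚ ⥤ Type :=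
  opOp _ ⋙ (algSpec (CommRingCat.of ℚ)).op ⋙ yoneda.obj S

/-- The coordinate ring of the affine subvariety of affine `n`-space over `ℚ` defined by the
system `f i = 0`. -/
abbrev systemRing {n m : ℕ} (f : Fin m → MvPolynomial (Fin n) ℤ) : Type :=
  MvPolynomial (Fin n) ℚ ⧸
    Ideal.span (Set.range fun i => MvPolynomial.map (Int.castRingHom ℚ) (f i))

/-- The affine subvariety of affine `n`-space over `ℚ` defined by the system `f i = 0`. -/
def systemScheme {n m : ℕ} (f : Fin m → MvPolynomial (Fin n) ℤ) : Over SpecQ :=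
  (algSpec (CommRingCat.of ℚ)).obj (Opposite.op (CommAlgCat.of ℚ (systemRing f)))

/-- The `j`-th coordinate function on the variety defined by the system. -/
def systemCoord {n m : ℕ} (f : Fin m → MvPolynomial (Fin n) ℤ) (j : Fin n) : systemRing f :=
  Ideal.Quotient.mk _ (MvPolynomial.X j)

/-- The `R`-point of the variety defined by the system which is given by a `ℚ`-algebra
homomorphism from the coordinate ring to `R`. -/
def systemPoint {n m : ℕ} (f : Fin m → MvPolynomial (Fin n) ℤ) (R : CommAlgCat.{0} ℚ)
    (p : CommAlgCat.of ℚ (systemRing f) ⟶ R) : (pointsFunctor (systemScheme f)).obj R :=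
  (algSpec (CommRingCat.of ℚ)).map p.op

end

/-!
The proof is an algebraic form of von Staudt's calculus of throws. On the axis `y = 0` the marked
points `[x_j : 0 : 1]` have free affine coordinates `x_j`, and sums, differences and products of
coordinates can be constructed by drawing lines and intersecting them. Two points have a
well-defined join over every ring, functorially, precisely when the cross product of their
coordinates is unimodular, that is, when they stay independent over all residue fields; dually for
lines. All constructions used here have this property for all values of the parameters, so that
every new element has one and only one realization over every ring
(`ProjPlane.hasCoords_crossProduct`) and no further point has to be marked.

Abstract arrangements are read off from explicit ones. A `Configuration` is a set of points and
lines whose coordinates are polynomials over `ℤ` in the parameters `x_1, …, x_n`. The invariant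
`Configuration.IsConstructible` says in particular that it is rigid: a realization, over any ring
`R`, of the incidences that hold identically is the specialization at some `x ∈ Rⁿ`. It
persists when joins and intersections are added, and the geometric addition, negation and
multiplication show that every polynomial `f` can be represented, in the sense that the lines
`x = f` and `y = f` belong to some constructible configuration
(`Configuration.exists_isConstructible_represents`). To impose the equations `f i = 0`, incidence
is tested modulo the ideal generated by the `f i`: then the origin lies on `y = f i`, which
forces `f i = 0` in a realization, while each solution of the system gives a realization. So the
functor of finite based realizations is corepresented by the coordinate ring of the system
(`Configuration.coyonedaIso`).

For a variety with a rational point, coordinates are chosen so that this point is the origin. Then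
the equations have no constant term, so they can be built from the coordinates by ring operations
without using the constant `1` (`Configuration.mem_representable`), and all auxiliary
elements of the constructions degenerate to a few fixed positions when the inputs vanish.
-/

/-! ### Points of the projective plane with unimodular coordinates -/

/-- A vector in `R³` is unimodular if some linear form takes the value `1` at it. -/
def IsUnimodular {R : Type*} [CommRing R] (u : Fin 3 → R) : Prop :=
  ∃ c : Fin 3 → R, c ⬝ᵥ u = 1

section ProjPlane

open scoped Matrix

variable {R S : Type*} [CommRing R] [CommRing S]

theorem IsUnimodular.comp (f : R →+* S) {u : Fin 3 → R} (h : IsUnimodular u) :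
    IsUnimodular (f ∘ u) := by
  obtain ⟨c, hc⟩ := h
  exact ⟨f ∘ c, by rw [← RingHom.map_dotProduct, hc, map_one]⟩

theorem IsUnimodular.of_eq_one {u : Fin 3 → R} (i : Fin 3) (h : u i = 1) : IsUnimodular u :=
  ⟨Pi.single i 1, by simp [h]⟩

theorem IsUnimodular.ne_zero [Nontrivial R] {u : Fin 3 → R} (h : IsUnimodular u) : u ≠ 0 := by
  rintro rfl
  obtain ⟨c, hc⟩ := h
  simp at hc

theorem ringHom_comp_crossProduct (f : R →+* S) (u v : Fin 3 → R) :
    f ∘ (u ⨯₃ v) = (f ∘ u) ⨯₃ (f ∘ v) := by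
  ext i
  fin_cases i <;> simp [cross_apply]

/-- The point of the projective plane with given unimodular homogeneous coordinates. -/
noncomputable def ProjPlane.ofUnimodular (u : Fin 3 → R) (h : IsUnimodular u) : ProjPlane R := by
  have hc := h.choose_spec
  set c := h.choose
  -- the form `c` identifies `R u` with `R`, and its kernel is a complement of `R u`
  let q : (Fin 3 → R) →ₗ[R] R := ∑ i, c i • LinearMap.proj i
  have hq : ∀ v, q v = c ⬝ᵥ v := fun v => by simp [q, dotProduct]
  let e : Submodule.span R {u} ≃ₗ[R] R :=
    LinearEquiv.ofBijective (q.domRestrict (Submodule.span R {u})) ⟨by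
        rintro ⟨x, hx⟩ ⟨y, hy⟩ hxy
        obtain ⟨a, rfl⟩ := Submodule.mem_span_singleton.1 hx
        obtain ⟨b, rfl⟩ := Submodule.mem_span_singleton.1 hy
        have : a = b := by simpa [hq, hc] using hxy
        simp [this],
      fun a => ⟨⟨a • u, Submodule.smul_mem _ _ (Submodule.mem_span_singleton_self u)⟩, by
        simp [hq, hc]⟩⟩
  have hcompl : IsCompl (Submodule.span R {u}) (LinearMap.ker q) := by
    refine IsCompl.of_eq ?_ ?_
    · rw [eq_bot_iff]
      rintro x ⟨hx, hx'⟩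
      obtain ⟨a, rfl⟩ := Submodule.mem_span_singleton.1 hx
      have : a = 0 := by simpa [hq, hc] using hx'
      simp [this]
    · rw [eq_top_iff]
      intro x _
      refine Submodule.mem_sup.2 ⟨q x • u, Submodule.smul_mem _ _
        (Submodule.mem_span_singleton_self u), x - q x • u, ?_, by simp⟩
      simp [hq, hc]
  exact
    { carrier := Submodule.span R {u}
      projective := Module.Projective.of_equiv e.symm
      projective_quotient :=
        have := Submodule.projective_of_isCompl hcompl.symm
        Module.Projective.of_equiv (Submodule.quotientEquivOfIsCompl _ _ hcompl).symm
      rank_eq_one := fun p => by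
        have : Nontrivial R := p.nontrivial
        rw [Module.rankAtStalk_eq_of_equiv e, Module.rankAtStalk_self]
        rfl }

theorem ProjPlane.hasCoords_ofUnimodular (u : Fin 3 → R) (h : IsUnimodular u) :
    (ProjPlane.ofUnimodular u h).HasCoords u := rfl

theorem ProjPlane.HasCoords.unique {V W : ProjPlane R} {u : Fin 3 → R} (hV : V.HasCoords u)
    (hW : W.HasCoords u) : V = W :=
  ProjPlane.ext (hV.trans hW.symm)

theorem ProjPlane.HasCoords.liesOn_iff {V : ProjPlane R} {L : DualProjPlane R}
    {u w : Fin 3 → R} (hV : V.HasCoords u) (hL : L.HasCoords w) :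
    V.LiesOn L ↔ w ⬝ᵥ u = 0 := by
  unfold ProjPlane.HasCoords at hV hL
  unfold ProjPlane.LiesOn
  rw [hV, hL]
  refine ⟨fun h => h _ (Submodule.mem_span_singleton_self w) _
    (Submodule.mem_span_singleton_self u), fun h a ha v hv => ?_⟩
  obtain ⟨a, rfl⟩ := Submodule.mem_span_singleton.1 ha
  obtain ⟨b, rfl⟩ := Submodule.mem_span_singleton.1 hv
  simp [h]

theorem ProjPlane.LiesOn.symm {V : ProjPlane R} {L : DualProjPlane R} (h : V.LiesOn L) :
    ProjPlane.LiesOn L V := fun a ha u hu => by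
  rw [dotProduct_comm]
  exact h u hu a ha

/-- A projective rank one direct summand of `R³` contained in another one is equal to it: the
projection of the generator `u` is a multiple `a • u`, and `a` is a unit because otherwise the
smaller summand would vanish over the residue field of a maximal ideal containing `a`. -/
theorem ProjPlane.hasCoords_of_le_span {V : ProjPlane R} {u : Fin 3 → R}
    (h : V.carrier ≤ Submodule.span R {u}) : V.HasCoords u := by
  refine le_antisymm h ?_
  obtain ⟨W, hW⟩ := V.carrier.exists_isCompl_of_projective_quotient V.projective_quotient
  have hu : V.carrier.projection W hW u ∈ V.carrier := by simp
  obtain ⟨a, ha⟩ := Submodule.mem_span_singleton.1 (h hu)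
  have hV : ∀ v ∈ V.carrier, ∃ c : R, v = (c * a) • u := by
    intro v hv
    obtain ⟨c, rfl⟩ := Submodule.mem_span_singleton.1 (h hv)
    refine ⟨c, ?_⟩
    have := Submodule.projection_apply_left hW ⟨c • u, hv⟩
    simp only [map_smul] at this
    rw [← this, ← ha, smul_smul]
  have ha' : IsUnit a := by
    by_contra hna
    obtain ⟨m, hm, ham⟩ := exists_max_ideal_of_mem_nonunits hna
    let V' := V.map (Ideal.Quotient.mk m)
    have hbot : V'.carrier = ⊥ := by
      rw [eq_bot_iff]
      refine Submodule.span_le.2 ?_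
      rintro _ ⟨v, hv, rfl⟩
      obtain ⟨c, rfl⟩ := hV v hv
      ext i
      have : (Ideal.Quotient.mk m) a = 0 := Ideal.Quotient.eq_zero_iff_mem.2 ham
      simp [this]
    have : Subsingleton V'.carrier := by rw [hbot]; infer_instance
    obtain ⟨p⟩ : Nonempty (PrimeSpectrum (R ⧸ m)) := inferInstance
    have h1 := V'.rank_eq_one p
    rw [Module.rankAtStalk_eq_zero_of_subsingleton] at h1
    simp at h1
  rw [Submodule.span_singleton_le_iff_mem]
  obtain ⟨b, rfl⟩ := ha'
  have := V.carrier.smul_mem (↑b⁻¹ : R) hu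
  rwa [← ha, smul_smul, Units.inv_mul, one_smul] at this

/-- A point lying on two lines that are independent over every residue field is their
intersection, given by the cross product. -/
theorem ProjPlane.hasCoords_crossProduct {V : ProjPlane R} {L L' : DualProjPlane R}
    {w w' : Fin 3 → R} (hL : L.HasCoords w) (hL' : L'.HasCoords w')
    (hu : IsUnimodular (w ⨯₃ w')) (h : V.LiesOn L) (h' : V.LiesOn L') :
    V.HasCoords (w ⨯₃ w') := by
  refine ProjPlane.hasCoords_of_le_span fun v hv => ?_
  obtain ⟨c, hc⟩ := hu
  have h1 : w ⬝ᵥ v = 0 := h w (hL ▸ Submodule.mem_span_singleton_self w) v hv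
  have h2 : w' ⬝ᵥ v = 0 := h' w' (hL' ▸ Submodule.mem_span_singleton_self w') v hv
  have h3 : (w ⨯₃ w') ⨯₃ v = 0 := by
    rw [cross_cross_eq_smul_sub_smul, h1, h2]; simp
  have h4 := cross_cross_eq_smul_sub_smul' c (w ⨯₃ w') v
  rw [h3, map_zero, dotProduct_comm _ c, hc, one_smul, eq_comm, sub_eq_zero] at h4
  exact Submodule.mem_span_singleton.2 ⟨_, h4⟩

theorem mem_lineAtInfinity_iff (v : Fin 3 → R) : v ∈ lineAtInfinity R ↔ v 2 = 0 := by
  rw [lineAtInfinity, Submodule.mem_span_pair]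
  constructor
  · rintro ⟨a, b, rfl⟩
    simp
  · intro h
    exact ⟨v 0, v 1, by ext i; fin_cases i <;> simp [h]⟩

/-- The finite points on the line `l_x` are the points `[x : 0 : 1]`. -/
theorem ProjPlane.IsFinite.exists_hasCoords {V : ProjPlane R} {L : DualProjPlane R}
    (hV : V.IsFinite) (hL : L.HasCoords ![0, 1, 0]) (h : V.LiesOn L) :
    ∃ x : R, V.HasCoords ![x, 0, 1] := by
  have hy : ∀ v ∈ V.carrier, v 1 = 0 := fun v hv => by
    have hm : (![0, 1, 0] : Fin 3 → R) ∈ L.carrier := hL ▸ Submodule.mem_span_singleton_self _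
    simpa [dotProduct, Fin.sum_univ_three] using h _ hm v hv
  have he : (![0, 0, 1] : Fin 3 → R) ∈ V.carrier ⊔ lineAtInfinity R := by
    rw [hV.sup_eq_top]; trivial
  obtain ⟨v, hv, l, hl, hvl⟩ := Submodule.mem_sup.1 he
  have hv2 : v 2 = 1 := by
    have := congrFun hvl 2
    simpa [(mem_lineAtInfinity_iff l).1 hl] using this
  have hve : v = ![v 0, 0, 1] := by
    ext i; fin_cases i <;> simp [hy v hv, hv2]
  refine ⟨v 0, ?_⟩
  rw [← hve]
  refine le_antisymm (fun u hu => ?_) ((Submodule.span_singleton_le_iff_mem _ _).2 hv)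
  have : u - u 2 • v ∈ (⊥ : Submodule R (Fin 3 → R)) := by
    rw [← hV.inf_eq_bot]
    refine ⟨V.carrier.sub_mem hu (V.carrier.smul_mem _ hv), (mem_lineAtInfinity_iff _).2 ?_⟩
    simp [hv2]
  rw [Submodule.mem_bot, sub_eq_zero] at this
  exact Submodule.mem_span_singleton.2 ⟨_, this.symm⟩

theorem ProjPlane.HasCoords.isFinite {V : ProjPlane R} {x : R} (h : V.HasCoords ![x, 0, 1]) :
    V.IsFinite := by
  unfold ProjPlane.IsFinite
  rw [show V.carrier = _ from h]
  refine IsCompl.of_eq ?_ ?_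
  · rw [eq_bot_iff]
    rintro v ⟨hv, hv'⟩
    obtain ⟨a, rfl⟩ := Submodule.mem_span_singleton.1 hv
    have : a = 0 := by simpa using (mem_lineAtInfinity_iff _).1 hv'
    simp [this]
  · rw [eq_top_iff]
    intro v _
    exact Submodule.mem_sup.2 ⟨v 2 • ![x, 0, 1], Submodule.smul_mem _ _
      (Submodule.mem_span_singleton_self _), v - v 2 • ![x, 0, 1],
      (mem_lineAtInfinity_iff _).2 (by simp), add_sub_cancel _ _⟩

theorem ProjPlane.HasCoords.left_unique {V : ProjPlane R} {x y : R}
    (hx : V.HasCoords ![x, 0, 1]) (hy : V.HasCoords ![y, 0, 1]) : x = y := by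
  have h : (![x, 0, 1] : Fin 3 → R) ∈ Submodule.span R {![y, 0, 1]} := by
    rw [← show V.carrier = _ from hy, show V.carrier = _ from hx]
    exact Submodule.mem_span_singleton_self _
  obtain ⟨a, ha⟩ := Submodule.mem_span_singleton.1 h
  have h2 : a = 1 := by simpa using congrFun ha 2
  simpa [h2] using (congrFun ha 0).symm

end ProjPlane

/-! ### Configurations given by polynomial coordinates -/

section Configuration

open scoped Matrix
open MvPolynomial

variable {n : ℕ}

/-- Homogeneous coordinates depending polynomially on `n` parameters. -/
abbrev PolyVec (n : ℕ) : Type := Fin 3 → MvPolynomial (Fin n) ℤ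

/-- The value of a vector of polynomials at the parameters `x`. -/
noncomputable def PolyVec.eval {R : Type*} [CommRing R] (x : Fin n → R) (u : PolyVec n) :
    Fin 3 → R :=
  eval₂Hom (Int.castRingHom R) x ∘ u

theorem PolyVec.eval_stdPt {R : Type*} [CommRing R] (x : Fin n → R) (t : TrianglePt) :
    PolyVec.eval x (stdPt _ t) = stdPt R t :=
  map_stdPt _ t

theorem PolyVec.eval_stdLn {R : Type*} [CommRing R] (x : Fin n → R) (t : TriangleLn) :
    PolyVec.eval x (stdLn _ t) = stdLn R t :=
  map_stdLn _ t

theorem stdPt_injective (R : Type*) [CommRing R] [Nontrivial R] :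
    Function.Injective (stdPt R) := by
  intro s t h
  have h0 := congrFun h 0
  have h1 := congrFun h 1
  have h2 := congrFun h 2
  cases s <;> cases t <;> simp_all [stdPt]

theorem stdLn_injective (R : Type*) [CommRing R] [Nontrivial R] :
    Function.Injective (stdLn R) := by
  intro s t h
  have h0 := congrFun h 0
  have h1 := congrFun h 1
  have h2 := congrFun h 2
  cases s <;> cases t <;> simp_all [stdLn]

theorem isUnimodular_stdPt (R : Type*) [CommRing R] (t : TrianglePt) :
    IsUnimodular (stdPt R t) := by
  cases t
  exacts [.of_eq_one 2 rfl, .of_eq_one 0 rfl, .of_eq_one 1 rfl, .of_eq_one 0 rfl,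
    .of_eq_one 0 rfl, .of_eq_one 1 rfl]

theorem isUnimodular_stdLn (R : Type*) [CommRing R] (t : TriangleLn) :
    IsUnimodular (stdLn R t) := by
  cases t
  exacts [.of_eq_one 1 rfl, .of_eq_one 0 rfl, .of_eq_one 2 rfl, .of_eq_one 0 rfl,
    .of_eq_one 0 rfl, .of_eq_one 1 rfl]

/-- The `j`-th marked point `[x_j : 0 : 1]`. -/
noncomputable def markedPt (j : Fin n) : PolyVec n := ![X j, 0, 1]

theorem PolyVec.eval_markedPt {R : Type*} [CommRing R] (x : Fin n → R) (j : Fin n) :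
    PolyVec.eval x (markedPt j) = ![x j, 0, 1] := by
  ext i
  fin_cases i <;> simp [PolyVec.eval, markedPt]

/-- The line `x = a`. -/
noncomputable def vertLine (a : MvPolynomial (Fin n) ℤ) : PolyVec n := ![1, 0, -a]

/-- The line `y = a`. -/
noncomputable def horizLine (a : MvPolynomial (Fin n) ℤ) : PolyVec n := ![0, 1, -a]

/-- The positions that points outside of the standard triangle may take at a base point. -/
def IsSpecialPt (R : Type*) [CommRing R] (u : Fin 3 → R) : Prop :=
  u = ![0, 0, 1] ∨ u = ![0, 1, 0] ∨ u = ![1, 0, 0] ∨ u = ![1, 1, 0]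

/-- The positions that lines outside of the standard triangle may take at a base point. -/
def IsSpecialLn (R : Type*) [CommRing R] (w : Fin 3 → R) : Prop :=
  w = stdLn R .lx ∨ w = stdLn R .ly ∨ w = stdLn R .ld

theorem IsSpecialPt.comp {R S : Type*} [CommRing R] [CommRing S] (f : R →+* S) {u : Fin 3 → R}
    (h : IsSpecialPt R u) : IsSpecialPt S (f ∘ u) := by
  rcases h with rfl | rfl | rfl | rfl
  · left; ext i; fin_cases i <;> simp
  · right; left; ext i; fin_cases i <;> simp
  · right; right; left; ext i; fin_cases i <;> simp
  · right; right; right; ext i; fin_cases i <;> simp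

theorem IsSpecialLn.comp {R S : Type*} [CommRing R] [CommRing S] (f : R →+* S) {w : Fin 3 → R}
    (h : IsSpecialLn R w) : IsSpecialLn S (f ∘ w) := by
  rcases h with rfl | rfl | rfl
  exacts [.inl (map_stdLn f _), .inr (.inl (map_stdLn f _)), .inr (.inr (map_stdLn f _))]

/-- A set of points and a set of lines in the projective plane, with coordinates depending
polynomially on `n` parameters. Points and lines are identified with their vectors of coordinates,
so proportional vectors count as different elements. -/
structure Configuration (n : ℕ) where
  pts : Set (PolyVec n)
  lns : Set (PolyVec n)

namespace Configuration

/-- A configuration is constructible if it contains the standard triangle and the marked points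
`[x_j : 0 : 1]`, satisfies the conditions for being the generic realization of an admissible
arrangement, and is *rigid*: each finite based realization over `R` of the incidences that hold
identically in the configuration is the specialization of the configuration at some `x ∈ Rⁿ`.

In the field `rigid` realizations are functions on all vectors of polynomials, of which only the
values on the configuration matter.

If `s` holds, moreover all elements outside of the standard triangle have to take special
positions when the parameters are set to `0`. -/
structure IsConstructible (s : Prop) (C : Configuration n) : Prop where
  finite_pts : C.pts.Finite
  finite_lns : C.lns.Finite
  stdPt_mem : ∀ t, stdPt _ t ∈ C.pts
  stdLn_mem : ∀ t, stdLn _ t ∈ C.lns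
  markedPt_mem : ∀ j, markedPt j ∈ C.pts
  isUnimodular_pt : ∀ u ∈ C.pts, IsUnimodular u
  isUnimodular_ln : ∀ w ∈ C.lns, IsUnimodular w
  exists_two_lns : ∀ u ∈ C.pts, ∃ w ∈ C.lns, ∃ w' ∈ C.lns, w ≠ w' ∧ w ⬝ᵥ u = 0 ∧ w' ⬝ᵥ u = 0
  exists_two_pts : ∀ w ∈ C.lns, ∃ u ∈ C.pts, ∃ u' ∈ C.pts, u ≠ u' ∧ w ⬝ᵥ u = 0 ∧ w ⬝ᵥ u' = 0
  rigid : ∀ (R : Type) [CommRing R] (p l : PolyVec n → ProjPlane R),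
    (∀ u ∈ C.pts, ∀ w ∈ C.lns, w ⬝ᵥ u = 0 → (p u).LiesOn (l w)) →
    (∀ t, (p (stdPt _ t)).HasCoords (stdPt R t)) →
    (∀ t, (l (stdLn _ t)).HasCoords (stdLn R t)) →
    (∀ j, (p (markedPt j)).IsFinite) →
    ∃ x : Fin n → R, (∀ u ∈ C.pts, (p u).HasCoords (u.eval x)) ∧
      ∀ w ∈ C.lns, (l w).HasCoords (w.eval x)
  isSpecialPt : s → ∀ u ∈ C.pts, u ∉ Set.range (stdPt (MvPolynomial (Fin n) ℤ)) →
    IsSpecialPt ℤ (constantCoeff ∘ u)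
  isSpecialLn : s → ∀ w ∈ C.lns, w ∉ Set.range (stdLn (MvPolynomial (Fin n) ℤ)) →
    IsSpecialLn ℤ (constantCoeff ∘ w)

/-- The standard triangle together with the marked points and the vertical lines through them. -/
noncomputable def initial (n : ℕ) : Configuration n where
  pts := Set.range (stdPt _) ∪ Set.range markedPt
  lns := Set.range (stdLn _) ∪ Set.range fun j => vertLine (X j)

theorem isConstructible_initial (s : Prop) : (initial n).IsConstructible s where
  finite_pts := (Set.finite_range _).union (Set.finite_range _)
  finite_lns := (Set.finite_range _).union (Set.finite_range _)
  stdPt_mem t := .inl ⟨t, rfl⟩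
  stdLn_mem t := .inl ⟨t, rfl⟩
  markedPt_mem j := .inr ⟨j, rfl⟩
  isUnimodular_pt := by
    rintro _ (⟨t, rfl⟩ | ⟨j, rfl⟩)
    exacts [isUnimodular_stdPt _ t, .of_eq_one 2 rfl]
  isUnimodular_ln := by
    rintro _ (⟨t, rfl⟩ | ⟨j, rfl⟩)
    exacts [isUnimodular_stdLn _ t, .of_eq_one 0 rfl]
  exists_two_lns := by
    rintro _ (⟨t, rfl⟩ | ⟨j, rfl⟩)
    · have key : ∃ l l', l ≠ l' ∧ TriangleInc t l ∧ TriangleInc t l' := by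
        cases t
        exacts [⟨.lx, .ly, by simp, .v00_lx, .v00_ly⟩, ⟨.lx, .linf, by simp, .vx_lx, .vx_linf⟩,
          ⟨.ly, .linf, by simp, .vy_ly, .vy_linf⟩, ⟨.ld, .ly1, by simp, .v11_ld, .v11_ly1⟩,
          ⟨.lx, .ly1, by simp, .v10_lx, .v10_ly1⟩, ⟨.ly, .lx1, by simp, .v01_ly, .v01_lx1⟩]
      obtain ⟨l, l', hne, h, h'⟩ := key
      exact ⟨_, .inl ⟨l, rfl⟩, _, .inl ⟨l', rfl⟩, (stdLn_injective _).ne hne,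
        std_inc t l h, std_inc t l' h'⟩
    · refine ⟨_, .inl ⟨.lx, rfl⟩, _, .inr ⟨j, rfl⟩, fun h => ?_, ?_, ?_⟩
      · simpa [stdLn, vertLine] using congrFun h 0
      · simp [stdLn, markedPt, dotProduct, Fin.sum_univ_three]
      · simp [vertLine, markedPt, dotProduct, Fin.sum_univ_three]
  exists_two_pts := by
    rintro _ (⟨t, rfl⟩ | ⟨j, rfl⟩)
    · have key : ∃ v v', v ≠ v' ∧ TriangleInc v t ∧ TriangleInc v' t := by
        cases t
        exacts [⟨.v00, .vx, by simp, .v00_lx, .vx_lx⟩, ⟨.v00, .vy, by simp, .v00_ly, .vy_ly⟩,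
          ⟨.vx, .vy, by simp, .vx_linf, .vy_linf⟩, ⟨.v00, .v11, by simp, .v00_ld, .v11_ld⟩,
          ⟨.v10, .v11, by simp, .v10_ly1, .v11_ly1⟩, ⟨.v01, .v11, by simp, .v01_lx1, .v11_lx1⟩]
      obtain ⟨v, v', hne, h, h'⟩ := key
      exact ⟨_, .inl ⟨v, rfl⟩, _, .inl ⟨v', rfl⟩, (stdPt_injective _).ne hne,
        std_inc v t h, std_inc v' t h'⟩
    · refine ⟨_, .inl ⟨.vy, rfl⟩, _, .inr ⟨j, rfl⟩, fun h => ?_, ?_, ?_⟩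
      · simpa [stdPt, markedPt] using congrFun h 2
      · simp [stdPt, vertLine, dotProduct, Fin.sum_univ_three]
      · simp [vertLine, markedPt, dotProduct, Fin.sum_univ_three]
  rigid := by
    intro R _ p l hinc hp hl hfin
    have hx : ∀ j, ∃ x : R, (p (markedPt j)).HasCoords ![x, 0, 1] := fun j =>
      (hfin j).exists_hasCoords (hl .lx) (hinc _ (.inr ⟨j, rfl⟩) _ (.inl ⟨.lx, rfl⟩)
        (by simp [stdLn, markedPt, dotProduct, Fin.sum_univ_three]))
    choose x hx using hx
    refine ⟨x, ?_, ?_⟩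
    · rintro _ (⟨t, rfl⟩ | ⟨j, rfl⟩)
      · rw [PolyVec.eval_stdPt]
        exact hp t
      · rw [PolyVec.eval_markedPt]
        exact hx j
    · rintro _ (⟨t, rfl⟩ | ⟨j, rfl⟩)
      · rw [PolyVec.eval_stdLn]
        exact hl t
      · have e : (vertLine (X j)).eval x = stdPt R .vy ⨯₃ ![x j, 0, 1] := by
          ext i
          fin_cases i <;> simp [PolyVec.eval, vertLine, stdPt, cross_apply]
        rw [e]
        refine ProjPlane.hasCoords_crossProduct (hp .vy) (hx j)
          (.of_eq_one 0 (by simp [stdPt, cross_apply])) ?_ ?_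
        · exact (hinc _ (.inl ⟨.vy, rfl⟩) _ (.inr ⟨j, rfl⟩)
            (by simp [stdPt, vertLine, dotProduct, Fin.sum_univ_three])).symm
        · exact (hinc _ (.inr ⟨j, rfl⟩) _ (.inr ⟨j, rfl⟩)
            (by simp [vertLine, markedPt, dotProduct, Fin.sum_univ_three])).symm
  isSpecialPt := by
    rintro - _ (h | ⟨j, rfl⟩) h'
    · exact absurd h h'
    · left; ext i; fin_cases i <;> simp [markedPt]
  isSpecialLn := by
    rintro - _ (h | ⟨j, rfl⟩) h'
    · exact absurd h h'
    · right; left; ext i; fin_cases i <;> simp [vertLine, stdLn]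

/-- Inclusion of configurations. -/
def Le (C D : Configuration n) : Prop := C.pts ⊆ D.pts ∧ C.lns ⊆ D.lns

theorem Le.trans {C D E : Configuration n} (h : C.Le D) (h' : D.Le E) : C.Le E :=
  ⟨h.1.trans h'.1, h.2.trans h'.2⟩

theorem ne_of_isUnimodular_cross {w w' : PolyVec n} (h : IsUnimodular (w ⨯₃ w')) : w ≠ w' := by
  rintro rfl
  exact h.ne_zero (cross_self w)

/-- A constructible configuration stays constructible if the intersection point of two of its
lines is added, provided that the lines are independent over every residue field. -/
theorem IsConstructible.exists_insert_pt {s : Prop} {C : Configuration n}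
    (hC : C.IsConstructible s) {w w' : PolyVec n} (hw : w ∈ C.lns) (hw' : w' ∈ C.lns)
    (u : PolyVec n) (hu : w ⨯₃ w' = u) (huni : IsUnimodular u)
    (hs : s → IsSpecialPt ℤ (constantCoeff ∘ u)) :
    ∃ D : Configuration n, D.IsConstructible s ∧ C.Le D ∧ u ∈ D.pts := by
  subst hu
  have h1 : w ⬝ᵥ (w ⨯₃ w') = 0 := dot_self_cross w w'
  have h2 : w' ⬝ᵥ (w ⨯₃ w') = 0 := dot_cross_self w w'
  refine ⟨⟨insert (w ⨯₃ w') C.pts, C.lns⟩, ?_, ⟨Set.subset_insert _ _, subset_rfl⟩,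
    Set.mem_insert _ _⟩
  exact
    { finite_pts := hC.finite_pts.insert _
      finite_lns := hC.finite_lns
      stdPt_mem := fun t => .inr (hC.stdPt_mem t)
      stdLn_mem := hC.stdLn_mem
      markedPt_mem := fun j => .inr (hC.markedPt_mem j)
      isUnimodular_pt := by
        rintro _ (rfl | h)
        exacts [huni, hC.isUnimodular_pt _ h]
      isUnimodular_ln := hC.isUnimodular_ln
      exists_two_lns := by
        rintro _ (rfl | h)
        exacts [⟨w, hw, w', hw', ne_of_isUnimodular_cross huni, h1, h2⟩, hC.exists_two_lns _ h]
      exists_two_pts := fun l hl => by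
        obtain ⟨u, hu, u', hu', h⟩ := hC.exists_two_pts l hl
        exact ⟨u, .inr hu, u', .inr hu', h⟩
      rigid := by
        intro R _ p l hinc hp hl hfin
        obtain ⟨x, hx, hx'⟩ := hC.rigid R p l (fun u hu => hinc u (.inr hu)) hp hl hfin
        refine ⟨x, ?_, hx'⟩
        rintro _ (rfl | h)
        · have huni' := huni.comp (eval₂Hom (Int.castRingHom R) x)
          rw [ringHom_comp_crossProduct] at huni'
          rw [PolyVec.eval, ringHom_comp_crossProduct]
          exact ProjPlane.hasCoords_crossProduct (hx' w hw) (hx' w' hw') huni'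
            (hinc _ (.inl rfl) w hw h1) (hinc _ (.inl rfl) w' hw' h2)
        · exact hx _ h
      isSpecialPt := by
        rintro h _ (rfl | h') h''
        exacts [hs h, hC.isSpecialPt h _ h' h'']
      isSpecialLn := hC.isSpecialLn }

/-- A constructible configuration stays constructible if the line through two of its points is
added, provided that the points are independent over every residue field. -/
theorem IsConstructible.exists_insert_ln {s : Prop} {C : Configuration n}
    (hC : C.IsConstructible s) {u u' : PolyVec n} (hu : u ∈ C.pts) (hu' : u' ∈ C.pts)
    (w : PolyVec n) (hw : u ⨯₃ u' = w) (huni : IsUnimodular w)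
    (hs : s → IsSpecialLn ℤ (constantCoeff ∘ w)) :
    ∃ D : Configuration n, D.IsConstructible s ∧ C.Le D ∧ w ∈ D.lns := by
  subst hw
  have h1 : (u ⨯₃ u') ⬝ᵥ u = 0 := by rw [dotProduct_comm]; exact dot_self_cross u u'
  have h2 : (u ⨯₃ u') ⬝ᵥ u' = 0 := by rw [dotProduct_comm]; exact dot_cross_self u u'
  refine ⟨⟨C.pts, insert (u ⨯₃ u') C.lns⟩, ?_, ⟨subset_rfl, Set.subset_insert _ _⟩,
    Set.mem_insert _ _⟩
  exact
    { finite_pts := hC.finite_pts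
      finite_lns := hC.finite_lns.insert _
      stdPt_mem := hC.stdPt_mem
      stdLn_mem := fun t => .inr (hC.stdLn_mem t)
      markedPt_mem := hC.markedPt_mem
      isUnimodular_pt := hC.isUnimodular_pt
      isUnimodular_ln := by
        rintro _ (rfl | h)
        exacts [huni, hC.isUnimodular_ln _ h]
      exists_two_lns := fun v hv => by
        obtain ⟨w, hw, w', hw', h⟩ := hC.exists_two_lns v hv
        exact ⟨w, .inr hw, w', .inr hw', h⟩
      exists_two_pts := by
        rintro _ (rfl | h)
        exacts [⟨u, hu, u', hu', ne_of_isUnimodular_cross huni, h1, h2⟩, hC.exists_two_pts _ h]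
      rigid := by
        intro R _ p l hinc hp hl hfin
        obtain ⟨x, hx, hx'⟩ := hC.rigid R p l (fun u hu w hw => hinc u hu w (.inr hw)) hp hl hfin
        refine ⟨x, hx, ?_⟩
        rintro _ (rfl | h)
        · have huni' := huni.comp (eval₂Hom (Int.castRingHom R) x)
          rw [ringHom_comp_crossProduct] at huni'
          rw [PolyVec.eval, ringHom_comp_crossProduct]
          exact ProjPlane.hasCoords_crossProduct (hx u hu) (hx u' hu') huni'
            (hinc u hu _ (.inl rfl) h1).symm (hinc u' hu' _ (.inl rfl) h2).symm
        · exact hx' _ h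
      isSpecialPt := hC.isSpecialPt
      isSpecialLn := by
        rintro h _ (rfl | h') h''
        exacts [hs h, hC.isSpecialLn h _ h' h''] }

/-! ### Geometric addition and multiplication -/

/-- The polynomial `a` is represented in a configuration if the lines `x = a` and `y = a` belong
to it. -/
def Represents (C : Configuration n) (a : MvPolynomial (Fin n) ℤ) : Prop :=
  vertLine a ∈ C.lns ∧ horizLine a ∈ C.lns

theorem Represents.mono {C D : Configuration n} {a : MvPolynomial (Fin n) ℤ}
    (h : C.Represents a) (hCD : C.Le D) : D.Represents a :=
  ⟨hCD.2 h.1, hCD.2 h.2⟩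

theorem IsConstructible.exists_represents_of_vertLine {s : Prop} {C : Configuration n}
    (hC : C.IsConstructible s) {a : MvPolynomial (Fin n) ℤ} (hs : s → constantCoeff a = 0)
    (ha : vertLine a ∈ C.lns) :
    ∃ D : Configuration n, D.IsConstructible s ∧ C.Le D ∧ D.Represents a := by
  -- the intersection with the diagonal
  obtain ⟨D, hD, hCD, h1⟩ := hC.exists_insert_pt (hC.stdLn_mem .ld) ha ![a, a, 1]
    (by ext i : 1; fin_cases i <;> simp [vertLine, stdLn, cross_apply]) (.of_eq_one 2 rfl)
    (fun h => .inl (by ext i; fin_cases i <;> simp [hs h]))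
  obtain ⟨E, hE, hDE, h2⟩ := hD.exists_insert_ln h1 (hD.stdPt_mem .vx) (horizLine a)
    (by ext i : 1; fin_cases i <;> simp [horizLine, stdPt, cross_apply]) (.of_eq_one 1 rfl)
    (fun h => .inl (by ext i; fin_cases i <;> simp [horizLine, stdLn, hs h]))
  exact ⟨E, hE, hCD.trans hDE, (hCD.trans hDE).2 ha, h2⟩

theorem IsConstructible.exists_represents_of_horizLine {s : Prop} {C : Configuration n}
    (hC : C.IsConstructible s) {a : MvPolynomial (Fin n) ℤ} (hs : s → constantCoeff a = 0)
    (ha : horizLine a ∈ C.lns) :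
    ∃ D : Configuration n, D.IsConstructible s ∧ C.Le D ∧ D.Represents a := by
  -- the intersection with the diagonal
  obtain ⟨D, hD, hCD, h1⟩ := hC.exists_insert_pt (hC.stdLn_mem .ld) ha ![a, a, 1]
    (by ext i : 1; fin_cases i <;> simp [horizLine, stdLn, cross_apply]) (.of_eq_one 2 rfl)
    (fun h => .inl (by ext i; fin_cases i <;> simp [hs h]))
  obtain ⟨E, hE, hDE, h2⟩ := hD.exists_insert_ln (hD.stdPt_mem .vy) h1 (vertLine a)
    (by ext i : 1; fin_cases i <;> simp [vertLine, stdPt, cross_apply]) (.of_eq_one 0 rfl)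
    (fun h => .inr (.inl (by ext i; fin_cases i <;> simp [vertLine, stdLn, hs h])))
  exact ⟨E, hE, hCD.trans hDE, h2, (hCD.trans hDE).2 ha⟩

/-- The point `(0, a)`. -/
theorem IsConstructible.exists_insert_yAxis_pt {s : Prop} {C : Configuration n}
    (hC : C.IsConstructible s) {a : MvPolynomial (Fin n) ℤ} (hs : s → constantCoeff a = 0)
    (ha : C.Represents a) :
    ∃ D : Configuration n, D.IsConstructible s ∧ C.Le D ∧ ![0, a, 1] ∈ D.pts :=
  hC.exists_insert_pt (hC.stdLn_mem .ly) ha.2 ![0, a, 1]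
    (by ext i : 1; fin_cases i <;> simp [horizLine, stdLn, cross_apply]) (.of_eq_one 2 rfl)
    (fun h => .inl (by ext i; fin_cases i <;> simp [hs h]))

/-- The line `y = x + a`, drawn through the point `(0, a)` and the point at infinity of the
diagonal. -/
theorem IsConstructible.exists_insert_parallel_diagonal {s : Prop} {C : Configuration n}
    (hC : C.IsConstructible s) {a : MvPolynomial (Fin n) ℤ} (hs : s → constantCoeff a = 0)
    (ha : C.Represents a) :
    ∃ D : Configuration n, D.IsConstructible s ∧ C.Le D ∧ ![1, -1, a] ∈ D.lns := by
  obtain ⟨D, hD, hCD, h1⟩ := hC.exists_insert_yAxis_pt hs ha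
  obtain ⟨E, hE, hDE, h2⟩ := hD.exists_insert_pt (hD.stdLn_mem .linf) (hD.stdLn_mem .ld)
    ![1, 1, 0] (by ext i : 1; fin_cases i <;> simp [stdLn, cross_apply]) (.of_eq_one 0 rfl)
    (fun _ => .inr (.inr (.inr (by ext i; fin_cases i <;> simp))))
  obtain ⟨F, hF, hEF, h3⟩ := hE.exists_insert_ln h2 (hDE.1 h1) ![1, -1, a]
    (by ext i : 1; fin_cases i <;> simp [cross_apply]) (.of_eq_one 0 rfl)
    (fun h => .inr (.inr (by ext i; fin_cases i <;> simp [stdLn, hs h])))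
  exact ⟨F, hF, (hCD.trans hDE).trans hEF, h3⟩

/-- Addition: the line `y = x + b` meets `x = a` in `(a, a + b)`. -/
theorem IsConstructible.exists_represents_add {s : Prop} {C : Configuration n}
    (hC : C.IsConstructible s) {a b : MvPolynomial (Fin n) ℤ} (hsa : s → constantCoeff a = 0)
    (hsb : s → constantCoeff b = 0) (ha : C.Represents a) (hb : C.Represents b) :
    ∃ D : Configuration n, D.IsConstructible s ∧ C.Le D ∧ D.Represents (a + b) := by
  obtain ⟨D, hD, hCD, h1⟩ := hC.exists_insert_parallel_diagonal hsb hb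
  obtain ⟨E, hE, hDE, h2⟩ := hD.exists_insert_pt h1 (hCD.2 ha.1) ![a, a + b, 1]
    (by ext i : 1; fin_cases i <;> simp [vertLine, cross_apply, add_comm]) (.of_eq_one 2 rfl)
    (fun h => .inl (by ext i; fin_cases i <;> simp [hsa h, hsb h]))
  obtain ⟨F, hF, hEF, h3⟩ := hE.exists_insert_ln h2 (hE.stdPt_mem .vx) (horizLine (a + b))
    (by ext i : 1; fin_cases i <;> simp [horizLine, stdPt, cross_apply]) (.of_eq_one 1 rfl)
    (fun h => .inl (by ext i; fin_cases i <;> simp [horizLine, stdLn, hsa h, hsb h]))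
  obtain ⟨G, hG, hFG, h4⟩ := hF.exists_represents_of_horizLine
    (fun h => by rw [map_add, hsa h, hsb h, add_zero]) h3
  exact ⟨G, hG, ((hCD.trans hDE).trans hEF).trans hFG, h4⟩

/-- Negation: the line `y = x + a` meets the first axis in `(-a, 0)`. -/
theorem IsConstructible.exists_represents_neg {s : Prop} {C : Configuration n}
    (hC : C.IsConstructible s) {a : MvPolynomial (Fin n) ℤ} (hs : s → constantCoeff a = 0)
    (ha : C.Represents a) :
    ∃ D : Configuration n, D.IsConstructible s ∧ C.Le D ∧ D.Represents (-a) := by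
  obtain ⟨D, hD, hCD, h1⟩ := hC.exists_insert_parallel_diagonal hs ha
  obtain ⟨E, hE, hDE, h2⟩ := hD.exists_insert_pt h1 (hD.stdLn_mem .lx) ![-a, 0, 1]
    (by ext i : 1; fin_cases i <;> simp [stdLn, cross_apply]) (.of_eq_one 2 rfl)
    (fun h => .inl (by ext i; fin_cases i <;> simp [hs h]))
  obtain ⟨F, hF, hEF, h3⟩ := hE.exists_insert_ln (hE.stdPt_mem .vy) h2 (vertLine (-a))
    (by ext i : 1; fin_cases i <;> simp [vertLine, stdPt, cross_apply]) (.of_eq_one 0 rfl)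
    (fun h => .inr (.inl (by ext i; fin_cases i <;> simp [vertLine, stdLn, hs h])))
  obtain ⟨G, hG, hFG, h4⟩ := hF.exists_represents_of_vertLine
    (fun h => by rw [map_neg, hs h, neg_zero]) h3
  exact ⟨G, hG, ((hCD.trans hDE).trans hEF).trans hFG, h4⟩

/-- Multiplication, up to sign: the line through the origin parallel to the line through `(0, b)`
and `(1, 0)` meets `x = a` in `(a, -a b)`. Parallels are drawn through the point at infinity
`[1 : -b : 0]`, which is in special position for `b = 0`, unlike the point `(1, b)`. -/
theorem IsConstructible.exists_represents_neg_mul {s : Prop} {C : Configuration n}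
    (hC : C.IsConstructible s) {a b : MvPolynomial (Fin n) ℤ} (hsa : s → constantCoeff a = 0)
    (hsb : s → constantCoeff b = 0) (ha : C.Represents a) (hb : C.Represents b) :
    ∃ D : Configuration n, D.IsConstructible s ∧ C.Le D ∧ D.Represents (-(a * b)) := by
  obtain ⟨D, hD, hCD, h1⟩ := hC.exists_insert_yAxis_pt hsb hb
  obtain ⟨E, hE, hDE, h2⟩ := hD.exists_insert_ln h1 (hD.stdPt_mem .v10) ![b, 1, -b]
    (by ext i : 1; fin_cases i <;> simp [stdPt, cross_apply]) (.of_eq_one 1 rfl)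
    (fun h => .inl (by ext i; fin_cases i <;> simp [stdLn, hsb h]))
  obtain ⟨F, hF, hEF, h3⟩ := hE.exists_insert_pt h2 (hE.stdLn_mem .linf) ![1, -b, 0]
    (by ext i : 1; fin_cases i <;> simp [stdLn, cross_apply]) (.of_eq_one 0 rfl)
    (fun h => .inr (.inr (.inl (by ext i; fin_cases i <;> simp [hsb h]))))
  obtain ⟨G, hG, hFG, h4⟩ := hF.exists_insert_ln (hF.stdPt_mem .v00) h3 ![b, 1, 0]
    (by ext i : 1; fin_cases i <;> simp [stdPt, cross_apply]) (.of_eq_one 1 rfl)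
    (fun h => .inl (by ext i; fin_cases i <;> simp [stdLn, hsb h]))
  have hCG := ((hCD.trans hDE).trans hEF).trans hFG
  obtain ⟨H, hH, hGH, h5⟩ := hG.exists_insert_pt (hCG.2 ha.1) h4 ![a, -(a * b), 1]
    (by ext i : 1; fin_cases i <;> simp [vertLine, cross_apply]) (.of_eq_one 2 rfl)
    (fun h => .inl (by ext i; fin_cases i <;> simp [hsa h]))
  obtain ⟨I, hI, hHI, h6⟩ := hH.exists_insert_ln h5 (hH.stdPt_mem .vx) (horizLine (-(a * b)))
    (by ext i : 1; fin_cases i <;> simp [horizLine, stdPt, cross_apply]) (.of_eq_one 1 rfl)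
    (fun h => .inl (by ext i; fin_cases i <;> simp [horizLine, stdLn, hsa h]))
  obtain ⟨J, hJ, hIJ, h7⟩ := hI.exists_represents_of_horizLine
    (fun h => by rw [map_neg, map_mul, hsa h, zero_mul, neg_zero]) h6
  exact ⟨J, hJ, ((hCG.trans hGH).trans hHI).trans hIJ, h7⟩

/-- The polynomials that can be represented in an extension of any given constructible
configuration. -/
def representable (n : ℕ) (s : Prop) : NonUnitalSubring (MvPolynomial (Fin n) ℤ) where
  carrier := {a | (s → constantCoeff a = 0) ∧ ∀ C : Configuration n, C.IsConstructible s →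
    ∃ D : Configuration n, D.IsConstructible s ∧ C.Le D ∧ D.Represents a}
  zero_mem' := by
    refine ⟨fun _ => map_zero _, fun C hC => ⟨C, hC, ⟨subset_rfl, subset_rfl⟩, ?_, ?_⟩⟩
    · simpa [vertLine, stdLn] using hC.stdLn_mem .ly
    · simpa [horizLine, stdLn] using hC.stdLn_mem .lx
  add_mem' := by
    rintro a b ⟨hsa, ha⟩ ⟨hsb, hb⟩
    refine ⟨fun h => by rw [map_add, hsa h, hsb h, add_zero], fun C hC => ?_⟩
    obtain ⟨D, hD, hCD, h1⟩ := ha C hC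
    obtain ⟨E, hE, hDE, h2⟩ := hb D hD
    obtain ⟨F, hF, hEF, h3⟩ := hE.exists_represents_add hsa hsb (h1.mono hDE) h2
    exact ⟨F, hF, (hCD.trans hDE).trans hEF, h3⟩
  neg_mem' := by
    rintro a ⟨hs, ha⟩
    refine ⟨fun h => by rw [map_neg, hs h, neg_zero], fun C hC => ?_⟩
    obtain ⟨D, hD, hCD, h1⟩ := ha C hC
    obtain ⟨E, hE, hDE, h2⟩ := hD.exists_represents_neg hs h1
    exact ⟨E, hE, hCD.trans hDE, h2⟩
  mul_mem' := by
    rintro a b ⟨hsa, ha⟩ ⟨hsb, hb⟩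
    refine ⟨fun h => by rw [map_mul, hsa h, zero_mul], fun C hC => ?_⟩
    obtain ⟨D, hD, hCD, h1⟩ := ha C hC
    obtain ⟨E, hE, hDE, h2⟩ := hb D hD
    obtain ⟨F, hF, hEF, h3⟩ := hE.exists_represents_neg_mul hsa hsb (h1.mono hDE) h2
    obtain ⟨G, hG, hFG, h4⟩ := hF.exists_represents_neg
      (fun h => by rw [map_neg, map_mul, hsa h, zero_mul, neg_zero]) h3
    exact ⟨G, hG, ((hCD.trans hDE).trans hEF).trans hFG, by rwa [neg_neg] at h4⟩

theorem X_mem_representable (s : Prop) (j : Fin n) : X j ∈ representable n s := by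
  refine ⟨fun _ => constantCoeff_X _ _, fun C hC => ?_⟩
  obtain ⟨D, hD, hCD, h1⟩ := hC.exists_insert_ln (hC.stdPt_mem .vy) (hC.markedPt_mem j)
    (vertLine (X j)) (by ext i : 1; fin_cases i <;> simp [vertLine, markedPt, stdPt, cross_apply])
    (.of_eq_one 0 rfl)
    (fun _ => .inr (.inl (by ext i; fin_cases i <;> simp [vertLine, stdLn])))
  obtain ⟨E, hE, hDE, h2⟩ := hD.exists_represents_of_vertLine (fun _ => constantCoeff_X _ _) h1
  exact ⟨E, hE, hCD.trans hDE, h2⟩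

theorem one_mem_representable {s : Prop} (hs : ¬ s) : 1 ∈ representable n s :=
  ⟨fun h => absurd h hs, fun C hC => ⟨C, hC, ⟨subset_rfl, subset_rfl⟩,
    hC.stdLn_mem .ly1, hC.stdLn_mem .lx1⟩⟩

/-- If the special position of all elements at the origin is required, the constant `1` is not
available, and precisely the polynomials without constant term can be represented. -/
theorem mem_representable {s : Prop} {f : MvPolynomial (Fin n) ℤ}
    (hf : s → constantCoeff f = 0) : f ∈ representable n s := by
  have key : ∀ g : MvPolynomial (Fin n) ℤ, g - C (constantCoeff g) ∈ representable n s := by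
    intro g
    induction g using MvPolynomial.induction_on with
    | C a => simp
    | add p q hp hq =>
      have e : p + q - C (constantCoeff (p + q)) =
          (p - C (constantCoeff p)) + (q - C (constantCoeff q)) := by
        simp only [map_add]; ring
      rw [e]
      exact add_mem hp hq
    | mul_X p i hp =>
      have e : p * X i - C (constantCoeff (p * X i)) =
          (p - C (constantCoeff p)) * X i + constantCoeff p • X i := by
        simp [sub_mul, smul_eq_C_mul]
      rw [e]
      exact add_mem (mul_mem hp (X_mem_representable s i))
        (zsmul_mem (X_mem_representable s i) _)
  have e : f = (f - C (constantCoeff f)) + constantCoeff f • 1 := by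
    simp [smul_eq_C_mul]
  rw [e]
  refine add_mem (key f) ?_
  by_cases hs : s
  · rw [hf hs, zero_smul]
    exact zero_mem _
  · exact zsmul_mem (one_mem_representable hs) _

/-- Finitely many polynomials can be represented simultaneously. -/
theorem exists_isConstructible_represents {s : Prop} {m : ℕ}
    (f : Fin m → MvPolynomial (Fin n) ℤ) (hf : s → ∀ i, constantCoeff (f i) = 0) :
    ∃ C : Configuration n, C.IsConstructible s ∧ ∀ i, C.Represents (f i) := by
  induction m with
  | zero => exact ⟨initial n, isConstructible_initial s, fun i => i.elim0⟩
  | succ m ih =>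
    obtain ⟨C, hC, h⟩ := ih (fun i => f i.castSucc) fun hs i => hf hs _
    obtain ⟨D, hD, hCD, h'⟩ := (mem_representable fun hs => hf hs (Fin.last m)).2 C hC
    exact ⟨D, hD, Fin.lastCases h' fun i => (h i).mono hCD⟩

end Configuration

end Configuration

/-! ### The arrangement of a configuration -/

section Realization

open scoped Matrix
open MvPolynomial

variable {n m : ℕ}

theorem markedPt_injective : Function.Injective (markedPt (n := n)) := fun i j h =>
  by simpa [markedPt] using congrFun h 0

/-- The parameters of the point of the variety of the system given by an algebra homomorphism. -/
noncomputable def systemParam (f : Fin m → MvPolynomial (Fin n) ℤ) {R : Type*} [CommRing R]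
    [Algebra ℚ R] (p : systemRing f →ₐ[ℚ] R) (j : Fin n) : R :=
  p (systemCoord f j)

theorem eval₂Hom_systemParam (f : Fin m → MvPolynomial (Fin n) ℤ) {R : Type*} [CommRing R]
    [Algebra ℚ R] (p : systemRing f →ₐ[ℚ] R) (g : MvPolynomial (Fin n) ℤ) :
    eval₂Hom (Int.castRingHom R) (systemParam f p) g =
      p (Ideal.Quotient.mk _ (map (Int.castRingHom ℚ) g)) := by
  have : eval₂Hom (Int.castRingHom R) (systemParam f p) =
      ((p : systemRing f →+* R).comp (Ideal.Quotient.mk _)).comp (map (Int.castRingHom ℚ)) := by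
    refine MvPolynomial.ringHom_ext (fun a => by simp) fun j => ?_
    simp [systemParam, systemCoord]
  rw [this]
  rfl

theorem eval₂Hom_systemParam_eq_zero (f : Fin m → MvPolynomial (Fin n) ℤ) {R : Type*}
    [CommRing R] [Algebra ℚ R] (p : systemRing f →ₐ[ℚ] R) {g : MvPolynomial (Fin n) ℤ}
    (hg : g ∈ Ideal.span (Set.range f)) :
    eval₂Hom (Int.castRingHom R) (systemParam f p) g = 0 := by
  have hle : Ideal.span (Set.range f) ≤
      RingHom.ker (eval₂Hom (Int.castRingHom R) (systemParam f p)) := by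
    rw [Ideal.span_le]
    rintro _ ⟨i, rfl⟩
    show eval₂Hom (Int.castRingHom R) (systemParam f p) (f i) = 0
    rw [eval₂Hom_systemParam, Ideal.Quotient.eq_zero_iff_mem.2
      (Ideal.subset_span (Set.mem_range_self i)), map_zero]
  exact hle hg

theorem exists_systemParam_eq (f : Fin m → MvPolynomial (Fin n) ℤ) {R : Type*} [CommRing R]
    [Algebra ℚ R] (x : Fin n → R) (hx : ∀ i, eval₂Hom (Int.castRingHom R) x (f i) = 0) :
    ∃ p : systemRing f →ₐ[ℚ] R, systemParam f p = x := by
  refine ⟨Ideal.Quotient.liftₐ _ (aeval x) fun g hg => ?_, ?_⟩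
  · have hle : Ideal.span (Set.range fun i => map (Int.castRingHom ℚ) (f i)) ≤
        RingHom.ker (aeval x : MvPolynomial (Fin n) ℚ →ₐ[ℚ] R) := by
      rw [Ideal.span_le]
      rintro _ ⟨i, rfl⟩
      show aeval x (map (Int.castRingHom ℚ) (f i)) = 0
      rw [← hx i, aeval_def, eval₂_map, coe_eval₂Hom]
      congr 1
      exact RingHom.ext_int _ _
    exact hle hg
  · ext j
    exact (Ideal.Quotient.lift_mk _ _ _).trans (aeval_X x j)

theorem systemParam_injective (f : Fin m → MvPolynomial (Fin n) ℤ) {R : Type*} [CommRing R]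
    [Algebra ℚ R] :
    Function.Injective (systemParam f : (systemRing f →ₐ[ℚ] R) → Fin n → R) := by
  intro p q h
  refine Ideal.Quotient.algHom_ext _ (MvPolynomial.algHom_ext fun j => ?_)
  exact congrFun h j

namespace Configuration

/-- The marked arrangement of a configuration: a point is incident to a line if this is so
modulo the equations `f i = 0`. -/
noncomputable def arrangement {s : Prop} {C : Configuration n} (hC : C.IsConstructible s)
    (f : Fin m → MvPolynomial (Fin n) ℤ) : MarkedArrangement where
  Pt := C.pts
  Ln := C.lns
  finite_pt := hC.finite_pts
  finite_ln := hC.finite_lns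
  Inc u w := w.1 ⬝ᵥ u.1 ∈ Ideal.span (Set.range f)
  base :=
    { pt := fun t => ⟨stdPt _ t, hC.stdPt_mem t⟩
      ln := fun t => ⟨stdLn _ t, hC.stdLn_mem t⟩
      inc := fun t l h => by
        show stdLn _ l ⬝ᵥ stdPt _ t ∈ _
        rw [std_inc t l h]
        exact zero_mem _ }
  base_isMono := ⟨fun _ _ h => stdPt_injective _ (Subtype.ext_iff.1 h),
    fun _ _ h => stdLn_injective _ (Subtype.ext_iff.1 h)⟩
  mark := Set.range fun j => ⟨markedPt j, hC.markedPt_mem j⟩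
  mark_inc := by
    rintro _ ⟨j, rfl⟩
    show stdLn _ .lx ⬝ᵥ markedPt j ∈ _
    simp [stdLn, markedPt, dotProduct, Fin.sum_univ_three]

section

variable {s : Prop} {C : Configuration n} (hC : C.IsConstructible s)
  (f : Fin m → MvPolynomial (Fin n) ℤ)

theorem arrangement_isAdmissible : (arrangement hC f).IsAdmissible := by
  constructor
  · rintro ⟨u, hu⟩
    obtain ⟨w, hw, w', hw', hne, h, h'⟩ := hC.exists_two_lns u hu
    refine ⟨⟨w, hw⟩, ⟨w', hw'⟩, fun e => hne (Subtype.ext_iff.1 e), ?_, ?_⟩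
    · show w ⬝ᵥ u ∈ _
      rw [h]; exact zero_mem _
    · show w' ⬝ᵥ u ∈ _
      rw [h']; exact zero_mem _
  · rintro ⟨w, hw⟩
    obtain ⟨u, hu, u', hu', hne, h, h'⟩ := hC.exists_two_pts w hw
    refine ⟨⟨u, hu⟩, ⟨u', hu'⟩, fun e => hne (Subtype.ext_iff.1 e), ?_, ?_⟩
    · show w ⬝ᵥ u ∈ _
      rw [h]; exact zero_mem _
    · show w ⬝ᵥ u' ∈ _
      rw [h']; exact zero_mem _

/-- The specialization of a configuration at a solution of the system. -/
noncomputable def realization {R : Type} [CommRing R] [Algebra ℚ R]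
    (p : systemRing f →ₐ[ℚ] R) : (arrangement hC f).FiniteBasedRealization R := by
  let x := systemParam f p
  have hp : ∀ u ∈ C.pts, IsUnimodular (u.eval x) := fun u hu => (hC.isUnimodular_pt u hu).comp _
  have hl : ∀ w ∈ C.lns, IsUnimodular (w.eval x) := fun w hw => (hC.isUnimodular_ln w hw).comp _
  exact
    ⟨{ pt := fun u => ProjPlane.ofUnimodular (u.1.eval x) (hp u.1 u.2)
       ln := fun w => ProjPlane.ofUnimodular (w.1.eval x) (hl w.1 w.2)
       inc := fun u w h => by
        refine (ProjPlane.HasCoords.liesOn_iff (ProjPlane.hasCoords_ofUnimodular _ _)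
          (ProjPlane.hasCoords_ofUnimodular _ _)).2 ?_
        rw [PolyVec.eval, PolyVec.eval, ← RingHom.map_dotProduct]
        exact eval₂Hom_systemParam_eq_zero f p h },
    ⟨fun t => by
        rw [← PolyVec.eval_stdPt x t]
        exact ProjPlane.hasCoords_ofUnimodular _ (hp _ (hC.stdPt_mem t)),
      fun t => by
        rw [← PolyVec.eval_stdLn x t]
        exact ProjPlane.hasCoords_ofUnimodular _ (hl _ (hC.stdLn_mem t))⟩, by
      rintro _ ⟨j, rfl⟩
      refine ProjPlane.HasCoords.isFinite (x := x j) ?_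
      rw [← PolyVec.eval_markedPt]
      exact ProjPlane.hasCoords_ofUnimodular _ (hp _ (hC.markedPt_mem j))⟩

variable {R : Type} [CommRing R] [Algebra ℚ R] (p : systemRing f →ₐ[ℚ] R)

theorem hasCoords_realization_pt (u : C.pts) :
    ((realization hC f p).1.pt u).HasCoords (u.1.eval (systemParam f p)) := rfl

theorem hasCoords_realization_ln (w : C.lns) :
    ((realization hC f p).1.ln w).HasCoords (w.1.eval (systemParam f p)) := rfl

theorem hasCoords_realization_markedPt (j : Fin n) :
    ((realization hC f p).1.pt ⟨markedPt j, hC.markedPt_mem j⟩).HasCoords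
      ![p (systemCoord f j), 0, 1] := by
  have e := PolyVec.eval_markedPt (systemParam f p) j
  exact e ▸ hasCoords_realization_pt hC f p ⟨markedPt j, hC.markedPt_mem j⟩

theorem realization_injective :
    Function.Injective (realization hC f : (systemRing f →ₐ[ℚ] R) → _) := by
  intro p q h
  refine systemParam_injective f (funext fun j => ?_)
  have := hasCoords_realization_markedPt hC f p j
  rw [h] at this
  exact this.left_unique (hasCoords_realization_markedPt hC f q j)

/-- If the configuration represents the polynomials `f i`, the incidence of the origin with the
line `y = f i` forces the equation `f i = 0`; hence rigidity shows that all finite based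
realizations come from solutions of the system. -/
theorem realization_surjective (hf : ∀ i, C.Represents (f i)) :
    Function.Surjective (realization hC f : (systemRing f →ₐ[ℚ] R) → _) := by
  classical
  intro ψ
  have h00 := hC.stdPt_mem .v00
  have hlx := hC.stdLn_mem .lx
  -- the values at vectors outside of the configuration are irrelevant
  let pt : PolyVec n → ProjPlane R := fun u =>
    if h : u ∈ C.pts then ψ.1.pt ⟨u, h⟩ else ψ.1.pt ⟨_, h00⟩
  let ln : PolyVec n → ProjPlane R := fun w =>
    if h : w ∈ C.lns then ψ.1.ln ⟨w, h⟩ else ψ.1.ln ⟨_, hlx⟩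
  have hpt : ∀ u (h : u ∈ C.pts), pt u = ψ.1.pt ⟨u, h⟩ := fun u h => dif_pos h
  have hln : ∀ w (h : w ∈ C.lns), ln w = ψ.1.ln ⟨w, h⟩ := fun w h => dif_pos h
  obtain ⟨x, hx, hx'⟩ := hC.rigid R pt ln
    (fun u hu w hw h => by
      rw [hpt u hu, hln w hw]
      refine ψ.1.inc ⟨u, hu⟩ ⟨w, hw⟩ ?_
      show w ⬝ᵥ u ∈ _
      rw [h]; exact zero_mem _)
    (fun t => by rw [hpt _ (hC.stdPt_mem t)]; exact ψ.2.1.1 t)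
    (fun t => by rw [hln _ (hC.stdLn_mem t)]; exact ψ.2.1.2 t)
    (fun j => by rw [hpt _ (hC.markedPt_mem j)]; exact ψ.2.2 _ ⟨j, rfl⟩)
  have hzero : ∀ i, eval₂Hom (Int.castRingHom R) x (f i) = 0 := by
    intro i
    have h := (hf i).2
    have hinc : (ψ.1.pt ⟨_, h00⟩).LiesOn (ψ.1.ln ⟨_, h⟩) := by
      refine ψ.1.inc ⟨_, h00⟩ ⟨_, h⟩ ?_
      show horizLine (f i) ⬝ᵥ stdPt _ .v00 ∈ _
      have e : horizLine (f i) ⬝ᵥ stdPt _ .v00 = -f i := by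
        simp [horizLine, stdPt, dotProduct, Fin.sum_univ_three]
      rw [e]
      exact neg_mem (Ideal.subset_span ⟨i, rfl⟩)
    have h1 := hx _ h00
    have h2 := hx' _ h
    rw [hpt _ h00] at h1
    rw [hln _ h] at h2
    have h3 := (h1.liesOn_iff h2).1 hinc
    simpa [PolyVec.eval, horizLine, stdPt, dotProduct, Fin.sum_univ_three] using h3
  obtain ⟨p, hp⟩ := exists_systemParam_eq f x hzero
  refine ⟨p, Subtype.ext (Realization.ext (funext fun u => ?_) (funext fun w => ?_))⟩
  · refine (hasCoords_realization_pt hC f p u).unique ?_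
    rw [hp]
    exact hpt u.1 u.2 ▸ hx u.1 u.2
  · refine (hasCoords_realization_ln hC f p w).unique ?_
    rw [hp]
    exact hln w.1 w.2 ▸ hx' w.1 w.2

theorem map_realization {S : Type} [CommRing S] [Algebra ℚ S] (g : R →ₐ[ℚ] S) :
    (realization hC f p).map g.toRingHom = realization hC f (g.comp p) := by
  have e : ∀ u : PolyVec n, g.toRingHom ∘ u.eval (systemParam f p) =
      u.eval (systemParam f (g.comp p)) := fun u => by
    ext i
    simp only [PolyVec.eval, Function.comp_apply, eval₂Hom_systemParam]
    rfl
  refine Subtype.ext (Realization.ext (funext fun u => ?_) (funext fun w => ?_))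
  · refine ProjPlane.HasCoords.unique ?_ (hasCoords_realization_pt hC f _ u)
    rw [← e]
    exact (hasCoords_realization_pt hC f p u).map _
  · refine ProjPlane.HasCoords.unique ?_ (hasCoords_realization_ln hC f _ w)
    rw [← e]
    exact (hasCoords_realization_ln hC f p w).map _

/-- The scheme of finite based realizations of the arrangement of a configuration is the spectrum
of the coordinate ring of the system. -/
noncomputable def coyonedaIso (hf : ∀ i, C.Represents (f i)) :
    coyoneda.obj (Opposite.op (CommAlgCat.of ℚ (systemRing f))) ≅ (arrangement hC f).BR₀ :=
  NatIso.ofComponents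
    (fun R => (Equiv.ofBijective (fun p => realization hC f p.hom)
      ⟨fun p q h => CommAlgCat.hom_ext (realization_injective hC f h), fun ψ => by
        obtain ⟨p, rfl⟩ := realization_surjective hC f hf ψ
        exact ⟨CommAlgCat.ofHom p, rfl⟩⟩).toIso)
    (fun {R S} g => by
      ext p
      exact (map_realization hC f p.hom g.hom).symm)

end

end Configuration

end Realization

/-! ### Affine varieties as systems of equations -/

section Affine

open Opposite MvPolynomial

/-- For a fully faithful contravariant functor `F`, the functor of points of `F B`, restricted to
the objects in the image of `F`, is corepresented by `B`. -/
def coyonedaIsoOfFullyFaithful {C D : Type*} [Category.{0} C] [Category.{0} D] {F : Cᵒᵖ ⥤ D}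
    (hF : F.FullyFaithful) (B : C) :
    coyoneda.obj (op B) ≅ opOp C ⋙ F.op ⋙ yoneda.obj (F.obj (op B)) :=
  NatIso.ofComponents (fun R => ((opEquiv (op R) (op B)).symm.trans hF.homEquiv).toIso)
    (fun {R S} g => by
      ext p
      exact F.map_comp g.op p.op)

/-- The functor of points of the spectrum of a `ℚ`-algebra is corepresented by the algebra. -/
noncomputable def pointsFunctorSpecIso (B : CommAlgCat.{0} ℚ) :
    coyoneda.obj (op B) ≅ pointsFunctor ((algSpec (CommRingCat.of ℚ)).obj (op B)) :=
  coyonedaIsoOfFullyFaithful (algSpec.fullyFaithful (R := CommRingCat.of ℚ)) B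

/-- Isomorphic schemes have isomorphic functors of points. -/
noncomputable def pointsFunctorMapIso {S T : Over SpecQ} (e : S ≅ T) :
    pointsFunctor S ≅ pointsFunctor T :=
  Functor.isoWhiskerLeft (opOp _) (Functor.isoWhiskerLeft (algSpec (CommRingCat.of ℚ)).op
    (yoneda.mapIso e))

/-- An affine variety over `ℚ` is the spectrum of a finitely generated `ℚ`-algebra. -/
theorem exists_iso_algSpec (S : Over SpecQ) (hS : IsAffine S.left)
    (hft : LocallyOfFiniteType S.hom) :
    ∃ B : CommAlgCat.{0} ℚ, Algebra.FiniteType ℚ B ∧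
      Nonempty ((algSpec (CommRingCat.of ℚ)).obj (op B) ≅ S) := by
  obtain ⟨B, ⟨e⟩⟩ := (essImage_algSpec (R := CommRingCat.of ℚ) (G := S)).2 hS
  refine ⟨B.unop, ?_, ⟨e⟩⟩
  have h1 : LocallyOfFiniteType (Spec.map (CommRingCat.ofHom (algebraMap ℚ B.unop))) := by
    have : IsIso e.hom.left := ((Over.forget _).mapIso e).isIso_hom
    have h2 : LocallyOfFiniteType (e.hom.left ≫ S.hom) := inferInstance
    rw [Over.w e.hom] at h2
    exact h2
  rw [HasRingHomProperty.Spec_iff (P := @LocallyOfFiniteType)] at h1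
  exact RingHom.finiteType_algebraMap.1 h1

/-- Clearing denominators. -/
theorem exists_map_eq_C_mul {σ : Type*} (g : MvPolynomial σ ℚ) :
    ∃ d : ℤ, d ≠ 0 ∧ ∃ f : MvPolynomial σ ℤ, map (Int.castRingHom ℚ) f = C (d : ℚ) * g := by
  induction g using MvPolynomial.induction_on with
  | C a =>
    refine ⟨a.den, by exact_mod_cast a.den_nz, C a.num, ?_⟩
    rw [map_C, ← C_mul]
    congr 1
    simp
  | add p q hp hq =>
    obtain ⟨d, hd, f, hf⟩ := hp
    obtain ⟨d', hd', f', hf'⟩ := hq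
    refine ⟨d * d', mul_ne_zero hd hd', C d' * f + C d * f', ?_⟩
    rw [map_add, map_mul, map_mul, map_C, map_C, hf, hf', Int.cast_mul, C_mul, eq_intCast,
      eq_intCast]
    ring
  | mul_X p i hp =>
    obtain ⟨d, hd, f, hf⟩ := hp
    exact ⟨d, hd, f * X i, by rw [map_mul, hf, map_X, mul_assoc]⟩

/-- Each quotient of a polynomial ring over `ℚ` is the coordinate ring of a system of equations
with integer coefficients. -/
theorem exists_systemRing_algEquiv {n : ℕ} {B : Type*} [CommRing B] [Algebra ℚ B]
    (π : MvPolynomial (Fin n) ℚ →ₐ[ℚ] B) (hπ : Function.Surjective π) :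
    ∃ (m : ℕ) (f : Fin m → MvPolynomial (Fin n) ℤ),
      (∀ i, π (map (Int.castRingHom ℚ) (f i)) = 0) ∧
      ∃ e : systemRing f ≃ₐ[ℚ] B, ∀ j, e (systemCoord f j) = π (X j) := by
  obtain ⟨m, g, hg⟩ := Submodule.fg_iff_exists_fin_generating_family.1
    (IsNoetherian.noetherian (RingHom.ker π))
  choose d hd f hf using fun i => exists_map_eq_C_mul (g i)
  have hu : ∀ i, IsUnit (C (d i : ℚ) : MvPolynomial (Fin n) ℚ) := fun i =>
    (isUnit_iff_ne_zero.2 (Int.cast_ne_zero.2 (hd i))).map C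
  have hker : Ideal.span (Set.range fun i => map (Int.castRingHom ℚ) (f i)) = RingHom.ker π := by
    rw [← hg]
    refine le_antisymm (Ideal.span_le.2 ?_) (Ideal.span_le.2 ?_)
    · rintro _ ⟨i, rfl⟩
      show map (Int.castRingHom ℚ) (f i) ∈ Ideal.span (Set.range g)
      rw [hf]
      exact Ideal.mul_mem_left _ _ (Ideal.subset_span ⟨i, rfl⟩)
    · rintro _ ⟨i, rfl⟩
      refine (Ideal.unit_mul_mem_iff_mem _ (hu i)).1 ?_
      rw [← hf]
      exact Ideal.subset_span ⟨i, rfl⟩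
  refine ⟨m, f, fun i => ?_, (Ideal.quotientEquivAlgOfEq ℚ hker).trans
    (Ideal.quotientKerAlgEquivOfSurjective hπ), fun j => rfl⟩
  have : map (Int.castRingHom ℚ) (f i) ∈ RingHom.ker π := hker ▸ Ideal.subset_span ⟨i, rfl⟩
  exact this

/-- Coordinates on an affine variety can be chosen in such a way that a given rational point is
the origin. -/
theorem exists_surjective_eq_zero {B : Type*} [CommRing B] [Algebra ℚ B]
    [hB : Algebra.FiniteType ℚ B] (q : B →ₐ[ℚ] ℚ) :
    ∃ (n : ℕ) (π : MvPolynomial (Fin n) ℚ →ₐ[ℚ] B), Function.Surjective π ∧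
      ∀ j, q (π (X j)) = 0 := by
  obtain ⟨n, π, hπ⟩ := Algebra.FiniteType.iff_quotient_mvPolynomial''.1 hB
  have hsurj : Function.Surjective
      (π.comp (aeval fun j => X j - C (q (π (X j))))) := by
    refine hπ.comp fun g => ⟨aeval (fun j => X j + C (q (π (X j)))) g, ?_⟩
    have : (aeval fun j => X j - C (q (π (X j)))).comp (aeval fun j => X j + C (q (π (X j)))) =
        AlgHom.id ℚ (MvPolynomial (Fin n) ℚ) := by
      ext j : 1
      simp [← algebraMap_eq]
    exact DFunLike.congr_fun this g
  refine ⟨n, _, hsurj, fun j => ?_⟩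
  simp [← algebraMap_eq]

/-- A presentation of the coordinate ring of an affine variety identifies its functor of points
with the functor of solutions of a system of equations with integer coefficients. -/
theorem exists_pointsFunctor_iso_coyoneda_systemRing {S : Over SpecQ} {B : CommAlgCat.{0} ℚ}
    (α : coyoneda.obj (op B) ≅ pointsFunctor S) {n : ℕ} (π : MvPolynomial (Fin n) ℚ →ₐ[ℚ] B)
    (hπ : Function.Surjective π) :
    ∃ (m : ℕ) (f : Fin m → MvPolynomial (Fin n) ℤ),
      (∀ i, π (map (Int.castRingHom ℚ) (f i)) = 0) ∧
      ∃ γ : pointsFunctor S ≅ coyoneda.obj (op (CommAlgCat.of ℚ (systemRing f))),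
        ∀ (R : CommAlgCat.{0} ℚ) (q : (pointsFunctor S).obj R) (j : Fin n),
          CommAlgCat.Hom.hom (γ.hom.app R q : CommAlgCat.of ℚ (systemRing f) ⟶ R)
            (systemCoord f j) =
          CommAlgCat.Hom.hom (α.inv.app R q : B ⟶ R) (π (X j)) := by
  obtain ⟨m, f, hf, e, he⟩ := exists_systemRing_algEquiv π hπ
  refine ⟨m, f, hf, α.symm ≪≫ coyoneda.mapIso (CommAlgCat.isoMk e).op, fun R q j => ?_⟩
  rw [← he]
  rfl

end Affine

/-! ### Universality -/

namespace Configuration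

open MvPolynomial

variable {n m : ℕ} {s : Prop} {C : Configuration n} (hC : C.IsConstructible s)
  (f : Fin m → MvPolynomial (Fin n) ℤ)

/-- The isomorphism from the variety of a system onto the scheme of finite based realizations. -/
noncomputable def systemIso (hf : ∀ i, C.Represents (f i)) :
    pointsFunctor (systemScheme f) ≅ (arrangement hC f).BR₀ :=
  (pointsFunctorSpecIso (CommAlgCat.of ℚ (systemRing f))).symm ≪≫ coyonedaIso hC f hf

theorem systemIso_hom_app_systemPoint (hf : ∀ i, C.Represents (f i)) (R : CommAlgCat.{0} ℚ)
    (p : CommAlgCat.of ℚ (systemRing f) ⟶ R) :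
    (systemIso hC f hf).hom.app R (systemPoint f R p) = realization hC f p.hom := by
  have h1 : systemPoint f R p = (pointsFunctorSpecIso _).hom.app R p := rfl
  have h2 := ConcreteCategory.congr_hom ((pointsFunctorSpecIso
    (CommAlgCat.of ℚ (systemRing f))).hom_inv_id_app R) p
  rw [h1]
  exact congrArg ((coyonedaIso hC f hf).hom.app R) h2

theorem eval_zero (R : Type*) [CommRing R] (u : PolyVec n) :
    u.eval (0 : Fin n → R) = Int.castRingHom R ∘ constantCoeff ∘ u := by
  have : eval₂Hom (Int.castRingHom R) (0 : Fin n → R) =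
      (Int.castRingHom R).comp constantCoeff :=
    MvPolynomial.ringHom_ext (fun a => by simp) fun j => by simp
  rw [PolyVec.eval, this]
  rfl

theorem isSpecialLn_realization_zero (hs : s) (p : systemRing f →ₐ[ℚ] ℚ)
    (hp : systemParam f p = 0) (w : C.lns)
    (hw : w ∉ Set.range (arrangement hC f).base.ln) :
    ∃ w', IsSpecialLn ℚ w' ∧ ((realization hC f p).1.ln w).HasCoords w' := by
  refine ⟨_, ?_, hasCoords_realization_ln hC f p w⟩
  rw [hp, eval_zero]
  refine IsSpecialLn.comp _ (hC.isSpecialLn hs _ w.2 ?_)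
  rintro ⟨t, ht⟩
  exact hw ⟨t, Subtype.ext ht⟩

theorem isSpecialPt_realization_zero (hs : s) (p : systemRing f →ₐ[ℚ] ℚ)
    (hp : systemParam f p = 0) (u : C.pts)
    (hu : u ∉ Set.range (arrangement hC f).base.pt) :
    ∃ u', IsSpecialPt ℚ u' ∧ ((realization hC f p).1.pt u).HasCoords u' := by
  refine ⟨_, ?_, hasCoords_realization_pt hC f p u⟩
  rw [hp, eval_zero]
  refine IsSpecialPt.comp _ (hC.isSpecialPt hs _ u.2 ?_)
  rintro ⟨t, ht⟩
  exact hu ⟨t, Subtype.ext ht⟩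

end Configuration

theorem mainTheorem3 :
    -- every affine variety over `ℚ` is isomorphic to some `BR₀(A)`
    (∀ S : Over SpecQ, IsAffine S.left → LocallyOfFiniteType S.hom →
      ∃ A : MarkedArrangement, Nonempty (pointsFunctor S ≅ A.BR₀)) ∧
    -- systems of polynomial equations with integer coefficients: the coordinates of the marked
    -- points give an isomorphism from `BR₀(A)`, for an admissible `A`, onto the variety of the
    -- system (`geo` is its inverse)
    (∀ (n m : ℕ) (f : Fin m → MvPolynomial (Fin n) ℤ),
      ∃ A : MarkedArrangement, A.IsAdmissible ∧
        ∃ v : Fin n → A.Pt, Function.Injective v ∧ Set.range v = A.mark ∧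
          ∃ geo : pointsFunctor (systemScheme f) ≅ A.BR₀,
            ∀ (R : CommAlgCat.{0} ℚ) (p : CommAlgCat.of ℚ (systemRing f) ⟶ R) (j : Fin n),
              ((geo.hom.app R (systemPoint f R p)).1.pt (v j)).HasCoords
                ![p.hom (systemCoord f j), 0, 1]) ∧
    -- varieties with a rational point: the point can be made to correspond to a realization
    -- that sends all elements outside of the standard triangle to a few fixed points and lines
    (∀ S : Over SpecQ, IsAffine S.left → LocallyOfFiniteType S.hom →
      ∀ q : (pointsFunctor S).obj (CommAlgCat.of ℚ ℚ),
        ∃ A : MarkedArrangement, A.IsAdmissible ∧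
          ∃ geo : pointsFunctor S ≅ A.BR₀,
            (∀ l : A.Ln, l ∉ Set.range A.base.ln →
              let L := (geo.hom.app (CommAlgCat.of ℚ ℚ) q).1.ln l
              L.HasCoords (stdLn ℚ .lx) ∨ L.HasCoords (stdLn ℚ .ly) ∨
                L.HasCoords (stdLn ℚ .ld)) ∧
            (∀ v : A.Pt, v ∉ Set.range A.base.pt →
              let V := (geo.hom.app (CommAlgCat.of ℚ ℚ) q).1.pt v
              V.HasCoords ![0, 0, 1] ∨ V.HasCoords ![0, 1, 0] ∨ V.HasCoords ![1, 0, 0] ∨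
                V.HasCoords ![1, 1, 0])) := by
  refine ⟨fun S hS hft => ?_, fun n m f => ?_, fun S hS hft q => ?_⟩
  · obtain ⟨B, hB, ⟨e⟩⟩ := exists_iso_algSpec S hS hft
    obtain ⟨n, π, hπ⟩ := Algebra.FiniteType.iff_quotient_mvPolynomial''.1 hB
    obtain ⟨m, f, -, γ, -⟩ := exists_pointsFunctor_iso_coyoneda_systemRing
      (pointsFunctorSpecIso B ≪≫ pointsFunctorMapIso e) π hπ
    obtain ⟨C, hC, hf⟩ := Configuration.exists_isConstructible_represents (s := False) f
      False.elim
    exact ⟨_, ⟨γ ≪≫ Configuration.coyonedaIso hC f hf⟩⟩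
  -- no base point here, so the constant `1` may be used and constant terms are allowed
  · obtain ⟨C, hC, hf⟩ := Configuration.exists_isConstructible_represents (s := False) f
      False.elim
    refine ⟨_, Configuration.arrangement_isAdmissible hC f,
      fun j => ⟨markedPt j, hC.markedPt_mem j⟩,
      fun i j h => markedPt_injective (Subtype.ext_iff.1 h), rfl,
      Configuration.systemIso hC f hf, fun R p j => ?_⟩
    rw [Configuration.systemIso_hom_app_systemPoint hC f hf R p]
    exact Configuration.hasCoords_realization_markedPt hC f p.hom j
  · obtain ⟨B, hB, ⟨e⟩⟩ := exists_iso_algSpec S hS hft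
    let α := pointsFunctorSpecIso B ≪≫ pointsFunctorMapIso e
    let q' : B ⟶ CommAlgCat.of ℚ ℚ := α.inv.app _ q
    obtain ⟨n, π, hπ, hq⟩ := exists_surjective_eq_zero q'.hom
    obtain ⟨m, f, hf0, γ, hγ⟩ := exists_pointsFunctor_iso_coyoneda_systemRing α π hπ
    -- the equations hold at the origin
    have hcc : ∀ i, MvPolynomial.constantCoeff (f i) = 0 := fun i => by
      have h1 : q'.hom.comp π = MvPolynomial.aeval (0 : Fin n → ℚ) :=
        MvPolynomial.algHom_ext fun j => by simp [hq]
      have h2 : q'.hom.comp π (MvPolynomial.map (Int.castRingHom ℚ) (f i)) = 0 := by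
        rw [AlgHom.comp_apply, hf0, map_zero]
      rw [h1] at h2
      simpa [MvPolynomial.constantCoeff_map] using h2
    obtain ⟨C, hC, hf⟩ := Configuration.exists_isConstructible_represents (s := True) f
      fun _ => hcc
    let p : CommAlgCat.of ℚ (systemRing f) ⟶ CommAlgCat.of ℚ ℚ := γ.hom.app _ q
    have hp : systemParam f p.hom = 0 := funext fun j => (hγ _ q j).trans (hq j)
    refine ⟨_, Configuration.arrangement_isAdmissible hC f,
      γ ≪≫ Configuration.coyonedaIso hC f hf, fun l hl => ?_, fun v hv => ?_⟩
    · obtain ⟨w, rfl | rfl | rfl, hw⟩ :=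
        Configuration.isSpecialLn_realization_zero hC f trivial p.hom hp l hl
      exacts [.inl hw, .inr (.inl hw), .inr (.inr hw)]
    · obtain ⟨u, rfl | rfl | rfl | rfl, hu⟩ :=
        Configuration.isSpecialPt_realization_zero hC f trivial p.hom hp v hv
      exacts [.inl hu, .inr (.inl hu), .inr (.inr (.inl hu)), .inr (.inr (.inr hu))]
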